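/- **Conventions.** Let $L,n$ be positive integers and let $\mathcal M(L,n)$ be the set of $L\times n$ matrices with entries in $\{0,1\}$. Rows are numbered $1,\dots,L$ from bottom to top and columns $1,\dots,n$ from left to right; an entry $1$ is called a ball. Write $B=(B_1,\dots,B_L)$, where $B_r\subseteq\{1,\dots,n\}$ is the set of columns of the balls in row $r$. **Collapsing.** For an upper row $B_{i+1}$ and the row $B_i$ below it, scan the columns from left to right, writing in each column first "(" if it belongs to $B_{i+1}$ and then ")" if it belongs to $B_i$, and match parentheses in the usual way. The dropping operator $e_i^\star$ moves every ball of row $i+1$ whose "(" is unmatched down to row $i$, within its column. Put $e^\star_{[1,b]}=e^\star_1e^\star_2\cdots e^\star_b$ (operators act from right to left) and $$\rho^{\downarrow}(B)=e^\star_{[1,L-1]}\,e^\star_{[1,L-2]}\cdots e^\star_{[1,1]}(B),\qquad \rho^{\leftarrow}(B)=\mathrm{rot}^{-1}\bigl(\rho^{\downarrow}(\mathrm{rot}(B))\bigr),$$ where $\mathrm{rot}:\mathcal M(L,n)\to\mathcal M(n,L)$ is the rotation by $90^\circ$ counterclockwise. **Nonwrapping multiline queues.** For a partition $\lambda$ with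 conjugate $\lambda'$ and an integer $n\ge\ell(\lambda)$, a multiline queue of shape $(\lambda,n)$ is a tuple $M=(B_1,\dots,B_{\lambda_1})$ of subsets of $\{1,\dots,n\}$ with $|B_j|=\lambda'_j$. The Ferrari–Martin algorithm labels its balls as follows. For $r=\lambda_1,\dots,2$, every unlabelled ball of row $r$ gets the label $r$; then the balls of row $r$, taken from the largest label to the smallest and from left to right among equal labels, are paired one at a time with the first unlabelled ball of row $r-1$ weakly to the right, wrapping around from column $n$ to column $1$ if necessary, and the ball found receives the same label. The major index $\mathrm{maj}(M)$ is the sum of $\ell-r+1$ over all pairings that wrap, where $\ell$ is the label of the pairing and $r$ is the row from which it originates. Let $\mathrm{MLQ}_0(\lambda,n)$ be the set of multiline queues of shape $(\lambda,n)$ with $\mathrm{maj}(M)=0$. **Theorem.** The map $$\mathrm{mRSK}:\ \mathcal M(L,n)\longrightarrow\bigcup_{\lambda}\mathrm{MLQ}_0(\lambda',L)\times\mathrm{MLQ}_0(\lambda,n),\qquad B\longmapsto\bigl(\rho^{\leftarrow}(B),\rho^{\downarrow}(B)\bigr),$$ where the union is over all partitions $\lambda$ (including the empty one) with $\ell(\lambda)\le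 n$ and $\ell(\lambda')\le L$, is well defined and is a bijection. Here $\rho^{\downarrow}(B)$ is regarded as a multiline queue on $n$ columns by omitting its empty top rows, and $\rho^{\leftarrow}(B)$ is regarded as a multiline queue on $L$ columns through its rotation $\mathrm{rot}(\rho^{\leftarrow}(B))=\rho^{\downarrow}(\mathrm{rot}(B))$, again omitting empty top rows. -/

import Mathlib

/-!
Conventions.  Rows and columns are numbered from `0` (so row `r` here is the row usually called
`r + 1`); rows are numbered from bottom to top and columns from left to right.  Partitions are
Young diagrams `lam : YoungDiagram`, with parts `lam.rowLen i`; the parts of the conjugate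
partition are `lam.colLen j = lam.transpose.rowLen j`, the number of parts is `lam.colLen 0` and
the largest part is `lam.rowLen 0`.
-/

namespace MLQueue

/-! ### Parentheses matching and dropping operators -/

/-- The bracketing rule for an upper row `A` and the row `C` just below it.  The columns are scanned
from left to right and each column from top to bottom; a ball of `A` is an opening parenthesis and
a ball of `C` is a closing parenthesis.  The state of the scan is the stack of the opening
parentheses that are not matched so far; a closing parenthesis is matched with the top of the
stack, and is unmatched if the stack is empty. -/
def openStack {n : ℕ} (A C : Finset (Fin n)) : List (Fin n) :=
  (List.finRange n).foldl
    (fun s c =>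
      let s' := if c ∈ A then c :: s else s
      if c ∈ C then s'.tail else s')
    []

/-- The columns of the balls of the upper row `A` that are unmatched above, that is, that are not
matched with a ball of the lower row `C` under the bracketing rule. -/
def unmatchedAbove {n : ℕ} (A C : Finset (Fin n)) : Finset (Fin n) :=
  (openStack A C).toFinset

/-- The set of columns of the balls (the `true` entries) in row `r` of a binary matrix; it is empty
when there is no row `r`. -/
def rowSet {L n : ℕ} (B : Matrix (Fin L) (Fin n) Bool) (r : ℕ) : Finset (Fin n) :=
  Finset.univ.filter fun c => ∃ h : r < L, B ⟨r, h⟩ c = true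

/-- The dropping operator `e⋆` between row `i + 1` and row `i`: all balls of row `i + 1` that are
unmatched above move down to row `i`, each within its column. -/
def dropStar {L n : ℕ} (i : ℕ) (B : Matrix (Fin L) (Fin n) Bool) : Matrix (Fin L) (Fin n) Bool :=
  fun r c =>
    if (r : ℕ) = i + 1 then
      B r c && !decide (c ∈ unmatchedAbove (rowSet B (i + 1)) (rowSet B i))
    else if (r : ℕ) = i then
      B r c || decide (c ∈ unmatchedAbove (rowSet B (i + 1)) (rowSet B i))
    else B r c

/-- Drop from row `b + 1` to row `b`, then from row `b` to row `b - 1`, and so on, and finally from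
row `1` to row `0`. -/
def dropChain {L n : ℕ} : ℕ → Matrix (Fin L) (Fin n) Bool → Matrix (Fin L) (Fin n) Bool
  | 0, B => dropStar 0 B
  | b + 1, B => dropChain b (dropStar (b + 1) B)

/-- Collapse rows `1, …, k`, in this order, starting from the bottom. -/
def collapseRows {L n : ℕ} : ℕ → Matrix (Fin L) (Fin n) Bool → Matrix (Fin L) (Fin n) Bool
  | 0, B => B
  | k + 1, B => dropChain k (collapseRows k B)

/-- Downward collapsing `ρ^↓` of an `L × n` binary matrix. -/
def rhoDown {L n : ℕ} (B : Matrix (Fin L) (Fin n) Bool) : Matrix (Fin L) (Fin n) Bool :=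
  collapseRows (L - 1) B

/-- Rotation by 90 degrees counterclockwise: the leftmost column becomes the bottom row, and it is
read from top to bottom. -/
def rot {L n : ℕ} (B : Matrix (Fin L) (Fin n) Bool) : Matrix (Fin n) (Fin L) Bool :=
  fun c k => B k.rev c

/-- Rotation by 90 degrees clockwise, the inverse of `rot`. -/
def rotInv {L n : ℕ} (B : Matrix (Fin n) (Fin L) Bool) : Matrix (Fin L) (Fin n) Bool :=
  fun r c => B c r.rev

theorem rotInv_rot {L n : ℕ} (B : Matrix (Fin L) (Fin n) Bool) : rotInv (rot B) = B := by
  funext r c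
  simp [rot, rotInv]

theorem rot_rotInv {L n : ℕ} (B : Matrix (Fin n) (Fin L) Bool) : rot (rotInv B) = B := by
  funext r c
  simp [rot, rotInv]

/-- Leftward collapsing `ρ^←` of an `L × n` binary matrix. -/
def rhoLeft {L n : ℕ} (B : Matrix (Fin L) (Fin n) Bool) : Matrix (Fin L) (Fin n) Bool :=
  rotInv (rhoDown (rot B))

/-! ### Multiline queues, the Ferrari–Martin algorithm and the major index -/

/-- The multiline queues of shape `(lam, n)`: tuples of sets of columns, one for each of the
`lam.rowLen 0` rows, such that row `j` has `lam.colLen j` balls.  A tuple is written as a sequence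
that continues with empty rows above its top row (`lam.colLen j = 0` for `lam.rowLen 0 ≤ j`). -/
def MLQ (lam : YoungDiagram) (n : ℕ) : Set (ℕ → Finset (Fin n)) :=
  {M | ∀ j, (M j).card = lam.colLen j}

/-- The first site of `U` weakly to the right of column `a`, wrapping around from the last column
to the first one if necessary. -/
def firstFree {n : ℕ} (U : Finset (Fin n)) (a : Fin n) : Option (Fin n) :=
  ((List.finRange n).filter (fun d => a ≤ d) ++ (List.finRange n).filter (fun d => d < a)).find?
    (fun d => d ∈ U)

/-- Pair the balls `a` of a list, in the order of the list, each to the first ball of the lower row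
weakly to its right (cyclically) that is still free; `U` is the set of free balls.  The result is
the list of pairs (upper column, lower column). -/
def pairUp {n : ℕ} : List (Fin n) → Finset (Fin n) → List (Fin n × Fin n)
  | [], _ => []
  | a :: l, U =>
    match firstFree U a with
    | none => pairUp l U
    | some d => (a, d) :: pairUp l (U.erase d)

/-- The order in which the labelled balls of a row are paired: from the largest label to the
smallest one, and from left to right among balls with the same label (`List.mergeSort` is stable).
Label `0` stands for a vacancy. -/
def pairingOrder {n : ℕ} (lab : Fin n → ℕ) : List (Fin n) :=
  ((List.finRange n).filter fun c => 0 < lab c).mergeSort fun a b => lab b ≤ lab a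

/-- The pairings from a row with labels `lab` to the row `C` below it. -/
def rowPairings {n : ℕ} (lab : Fin n → ℕ) (C : Finset (Fin n)) : List (Fin n × Fin n) :=
  pairUp (pairingOrder lab) C

/-- The labels that the balls of row `r`, whose set of columns is `C`, receive when the row above
has labels `lab`: a ball that is paired inherits the label of its partner, and any other ball
gets the number of its row, which is `r + 1` when rows are counted from `1`.
Vacancies get `0`. -/
def nextLabels {n : ℕ} (lab : Fin n → ℕ) (C : Finset (Fin n)) (r : ℕ) : Fin n → ℕ :=
  fun d =>
    match (rowPairings lab C).find? (fun p => p.2 = d) with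
    | some p => lab p.1
    | none => if d ∈ C then r + 1 else 0

/-- `fmLabels M m r` is the Ferrari–Martin labelling of row `r` of a multiline queue that has `m`
rows from row `r` on upwards. -/
def fmLabels {n : ℕ} (M : ℕ → Finset (Fin n)) : ℕ → ℕ → Fin n → ℕ
  | 0, _ => fun _ => 0
  | m + 1, r => nextLabels (fmLabels M m (r + 1)) (M r) r

/-- The major index of a multiline queue with `k` rows: a pairing with label `l` from row `R` to
row `R - 1`, with rows counted from `1`, contributes `l - R + 1` if it wraps and `0` otherwise.
Below, `R = r + 2`, and always `R ≤ l`. -/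
def maj {n : ℕ} (k : ℕ) (M : ℕ → Finset (Fin n)) : ℕ :=
  ∑ r ∈ Finset.range (k - 1),
    ((rowPairings (fmLabels M (k - 1 - r) (r + 1)) (M r)).map fun p =>
      if p.2 < p.1 then fmLabels M (k - 1 - r) (r + 1) p.1 - (r + 1) else 0).sum

/-- The nonwrapping multiline queues of shape `(lam, n)`: those with major index zero. -/
def MLQ0 (lam : YoungDiagram) (n : ℕ) : Set (ℕ → Finset (Fin n)) :=
  {M | M ∈ MLQ lam n ∧ maj (lam.rowLen 0) M = 0}

/-- The map `B ↦ (ρ^←(B), ρ^↓(B))`.  The `L × n` matrix `ρ^←(B)` is read as an array on `L` columns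
in the direction of the collapsing, that is, its row `j` is column `j` of `ρ^←(B)` read from top
to bottom. -/
def mRSK {L n : ℕ} (B : Matrix (Fin L) (Fin n) Bool) :
    (ℕ → Finset (Fin L)) × (ℕ → Finset (Fin n)) :=
  (rowSet (rot (rhoLeft B)), rowSet (rhoDown B))

end MLQueue

/-! Dropping refines into elementary steps. `Step i` lowers only the leftmost ball of row `i + 1`
that is unmatched above; this is a partial injection, and `dropStar i` runs to the end of its
maximal string. `ColStep j` is the same operation on columns `j + 1` and `j`. The core of the proof
is that row steps commute with column steps in the strong sense that any two adjacent sides of a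
square complete to the whole square (`Step.diamond` and its three rotations), as in a bicrystal
structure on binary matrices.

By formal arguments on strings (`IsDrop.compatible`, `IsDrop.cartesian`), `rhoLeft` is compatible
with every row step, so `rhoLeft` and `rhoDown` form a pullback square
(`cartesian_rhoLeft_rhoDown`): they commute, `B` is determined by the pair of its images, and every
pair `(p, q)` with `rhoLeft q = rhoDown p` comes from some `B`. This already gives injectivity.

For the image, two facts are needed. A multiline queue has major index zero exactly when no ball is
unmatched above (`rowSet_mem_MLQ0_iff`), and `rhoDown` always produces such a matrix
(`unmatched_rhoDown`). A matrix collapsed in both directions is the staircase of a Young diagram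
(`staircase_of_unmatched_eq_empty`). Downward collapsing preserves column sums and leftward
collapsing preserves row sums, so the staircase `rhoDown (rhoLeft B)` records the common shape of
both components. Conversely, for a pair of nonwrapping queues of conjugate shapes, collapsing each
in the other direction yields the same staircase, and the pullback property supplies a preimage. -/

namespace MLQueue

/-! ### Heights and elementary lowering steps -/

/-- The entry of a binary matrix as an integer, extended by `0` outside of the matrix. -/
def val {L n : ℕ} (B : Matrix (Fin L) (Fin n) Bool) (r c : ℕ) : ℤ :=
  if ∃ (h : r < L) (h' : c < n), B ⟨r, h⟩ ⟨c, h'⟩ = true then 1 else 0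

theorem val_eq_zero_or_one {L n : ℕ} (B : Matrix (Fin L) (Fin n) Bool) (r c : ℕ) :
    val B r c = 0 ∨ val B r c = 1 := by
  unfold val; split_ifs <;> simp

theorem val_row_of_le {L n : ℕ} (B : Matrix (Fin L) (Fin n) Bool) {r : ℕ} (c : ℕ) (h : L ≤ r) :
    val B r c = 0 := by
  unfold val
  rw [if_neg]
  rintro ⟨h1, -⟩
  omega

theorem val_col_of_le {L n : ℕ} (B : Matrix (Fin L) (Fin n) Bool) (r : ℕ) {c : ℕ} (h : n ≤ c) :
    val B r c = 0 := by
  unfold val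
  rw [if_neg]
  rintro ⟨-, h1, -⟩
  omega

theorem val_fin {L n : ℕ} (B : Matrix (Fin L) (Fin n) Bool) (r : Fin L) (c : Fin n) :
    val B r c = if B r c = true then 1 else 0 := by
  unfold val; simp

theorem ext_val {L n : ℕ} {B B' : Matrix (Fin L) (Fin n) Bool}
    (h : ∀ r c, val B r c = val B' r c) : B = B' := by
  funext r c
  have := h r c
  rw [val_fin, val_fin] at this
  cases h1 : B r c <;> cases h2 : B' r c <;> simp_all

/-- The matrix with prescribed entries. -/
def ofVal (L n : ℕ) (v : ℕ → ℕ → ℤ) : Matrix (Fin L) (Fin n) Bool :=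
  fun r c => decide (v r c = 1)

theorem val_ofVal {L n : ℕ} {v : ℕ → ℕ → ℤ} (h01 : ∀ r c, v r c = 0 ∨ v r c = 1)
    (hr : ∀ r c, L ≤ r → v r c = 0) (hc : ∀ r c, n ≤ c → v r c = 0) (r c : ℕ) :
    val (ofVal L n v) r c = v r c := by
  by_cases h1 : r < L
  · by_cases h2 : c < n
    · have := val_fin (ofVal L n v) ⟨r, h1⟩ ⟨c, h2⟩
      simp only at this
      rw [this]
      rcases h01 r c with h | h <;> simp [ofVal, h]
    · rw [val_col_of_le _ _ (by omega), hc _ _ (by omega)]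
  · rw [val_row_of_le _ _ (by omega), hr _ _ (by omega)]

theorem val_rot {L n : ℕ} (B : Matrix (Fin L) (Fin n) Bool) (c k : ℕ) :
    val (rot B) c k = if k < L then val B (L - 1 - k) c else 0 := by
  split_ifs with h
  · by_cases h2 : c < n
    · have e1 := val_fin (rot B) ⟨c, h2⟩ ⟨k, h⟩
      have e2 := val_fin B (⟨k, h⟩ : Fin L).rev ⟨c, h2⟩
      simp only [Fin.val_rev] at e1 e2
      rw [e1, show L - 1 - k = L - (k + 1) by omega, e2]
      rfl
    · rw [val_row_of_le _ _ (by omega), val_col_of_le _ _ (by omega)]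
  · exact val_col_of_le _ _ (by omega)

theorem rot_rot_rot_rot {L n : ℕ} (B : Matrix (Fin L) (Fin n) Bool) :
    rot (rot (rot (rot B))) = B := by
  funext r c
  simp [rot]

theorem val_rot_rot {L n : ℕ} (B : Matrix (Fin L) (Fin n) Bool) (r c : ℕ) :
    val (rot (rot B)) r c = if r < L ∧ c < n then val B (L - 1 - r) (n - 1 - c) else 0 := by
  rw [val_rot]
  by_cases h1 : c < n
  · rw [if_pos h1, val_rot]
    simp [h1]
  · simp [h1]

/-- The height at the boundary `x`: the number of opening minus the number of closing parentheses in
the columns before `x`, for the rows `i + 1` and `i`. -/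
def ht {L n : ℕ} (B : Matrix (Fin L) (Fin n) Bool) (i x : ℕ) : ℤ :=
  ∑ c ∈ Finset.range x, (val B (i + 1) c - val B i c)

theorem ht_zero {L n : ℕ} (B : Matrix (Fin L) (Fin n) Bool) (i : ℕ) : ht B i 0 = 0 := by
  simp [ht]

theorem ht_succ {L n : ℕ} (B : Matrix (Fin L) (Fin n) Bool) (i x : ℕ) :
    ht B i (x + 1) = ht B i x + (val B (i + 1) x - val B i x) :=
  Finset.sum_range_succ _ _

/-- Column `p` is the leftmost column of a ball of row `i + 1` that is unmatched above: the height
attains its minimum for the last time at `p`. -/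
def IsLeftmost {L n : ℕ} (i p : ℕ) (B : Matrix (Fin L) (Fin n) Bool) : Prop :=
  val B (i + 1) p = 1 ∧ val B i p = 0 ∧ (∀ x, x ≤ p → ht B i p ≤ ht B i x) ∧
    ∀ x, p < x → ht B i p < ht B i x

/-- `B'` arises from `B` by moving the leftmost ball of row `i + 1` that is unmatched above down to
row `i`. -/
def Step {L n : ℕ} (i : ℕ) (B B' : Matrix (Fin L) (Fin n) Bool) : Prop :=
  ∃ p, IsLeftmost i p B ∧ ∀ r c, val B' r c =
    val B r c + if c = p then (if r = i then 1 else 0) - (if r = i + 1 then 1 else 0) else 0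

theorem IsLeftmost.unique {L n : ℕ} {i p p' : ℕ} {B : Matrix (Fin L) (Fin n) Bool}
    (h : IsLeftmost i p B) (h' : IsLeftmost i p' B) : p = p' := by
  obtain ⟨-, -, h1, h2⟩ := h
  obtain ⟨-, -, h1', h2'⟩ := h'
  have := h1 p'; have := h2 p'; have := h1' p; have := h2' p
  omega

theorem IsLeftmost.exists_step {L n : ℕ} {i p : ℕ} {B : Matrix (Fin L) (Fin n) Bool}
    (h : IsLeftmost i p B) : ∃ B', Step i B B' := by
  obtain ⟨h1, h2, -⟩ := id h
  refine ⟨ofVal L n fun r c => val B r c +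
    if c = p then (if r = i then 1 else 0) - (if r = i + 1 then 1 else 0) else 0, p, h, ?_⟩
  intro r c
  have hp : p < n := by
    by_contra hh
    rw [val_col_of_le _ _ (by omega)] at h1; omega
  have hi : i + 1 < L := by
    by_contra hh
    rw [val_row_of_le _ _ (by omega)] at h1; omega
  rw [val_ofVal]
  · intro r c
    have := val_eq_zero_or_one B r c
    split_ifs <;> subst_vars <;> omega
  · intro r c hr
    rw [val_row_of_le _ _ hr]
    split_ifs <;> omega
  · intro r c hc
    rw [val_col_of_le _ _ hc]
    split_ifs <;> omega

theorem Step.functional {L n : ℕ} {i : ℕ} {B B₁ B₂ : Matrix (Fin L) (Fin n) Bool}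
    (h₁ : Step i B B₁) (h₂ : Step i B B₂) : B₁ = B₂ := by
  obtain ⟨p, hp, e1⟩ := h₁
  obtain ⟨p', hp', e2⟩ := h₂
  obtain rfl := hp.unique hp'
  exact ext_val fun r c => by rw [e1, e2]

theorem ht_of_step {L n : ℕ} {i p : ℕ} {B B' : Matrix (Fin L) (Fin n) Bool}
    (e : ∀ r c, val B' r c =
      val B r c + if c = p then (if r = i then 1 else 0) - (if r = i + 1 then 1 else 0) else 0)
    (x : ℕ) : ht B' i x = ht B i x - if p < x then 2 else 0 := by
  induction x with
  | zero => simp [ht_zero]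
  | succ x ih =>
    rw [ht_succ, ht_succ, ih, e, e]
    split_ifs <;> omega

theorem Step.lt {L n : ℕ} {i : ℕ} {B B' : Matrix (Fin L) (Fin n) Bool} (h : Step i B B') :
    i + 1 < L := by
  obtain ⟨p, ⟨h1, -⟩, -⟩ := h
  by_contra hh
  rw [val_row_of_le _ _ (by omega)] at h1; omega

theorem ht_rot_rot {L n : ℕ} (B : Matrix (Fin L) (Fin n) Bool) {i : ℕ} (hi : i + 1 < L) (x : ℕ) :
    ht (rot (rot B)) (L - 2 - i) x = ht B i (n - x) - ht B i n := by
  induction x with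
  | zero => simp [ht_zero]
  | succ x ih =>
    rw [ht_succ, ih, val_rot_rot, val_rot_rot]
    by_cases hx : x < n
    · rw [if_pos ⟨by omega, hx⟩, if_pos ⟨by omega, hx⟩, show n - x = n - (x + 1) + 1 by omega,
        ht_succ, show L - 1 - (L - 2 - i + 1) = i by omega,
        show L - 1 - (L - 2 - i) = i + 1 by omega, show n - 1 - x = n - (x + 1) by omega]
      ring
    · rw [if_neg (by omega), if_neg (by omega), show n - x = n - (x + 1) by omega]
      ring

/-- The rotation by 180 degrees exchanges opening and closing parentheses and reverses the scan.
After the move the height drops by 2 to the right of `p`, so it attains its minimum for the first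
time at `p + 1`; in the rotated matrix this is a last minimum. Reversibility turns determinism of
steps into injectivity. -/
theorem Step.flip {L n : ℕ} {i : ℕ} {B B' : Matrix (Fin L) (Fin n) Bool} (h : Step i B B') :
    Step (L - 2 - i) (rot (rot B')) (rot (rot B)) := by
  have hi := h.lt
  obtain ⟨p, ⟨h1, h2, h3, h4⟩, e⟩ := h
  have hp : p < n := by
    by_contra hh
    rw [val_col_of_le _ _ (by omega)] at h1; omega
  have hh := ht_of_step e
  have hs := ht_succ B i p
  refine ⟨n - 1 - p, ⟨?_, ?_, ?_, ?_⟩, ?_⟩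
  · rw [val_rot_rot, if_pos ⟨by omega, by omega⟩, e, show L - 1 - (L - 2 - i + 1) = i by omega,
      show n - 1 - (n - 1 - p) = p by omega]
    simp [h2]
  · rw [val_rot_rot, if_pos ⟨by omega, by omega⟩, e, show L - 1 - (L - 2 - i) = i + 1 by omega,
      show n - 1 - (n - 1 - p) = p by omega]
    simp [h1]
  · intro x hx
    rw [ht_rot_rot _ hi, ht_rot_rot _ hi, hh, hh, hh, show n - (n - 1 - p) = p + 1 by omega]
    have := h4 (n - x) (by omega)
    split_ifs <;> omega
  · intro x hx
    rw [ht_rot_rot _ hi, ht_rot_rot _ hi, hh, hh, hh, show n - (n - 1 - p) = p + 1 by omega]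
    have := h3 (n - x) (by omega)
    split_ifs <;> omega
  · intro r c
    rw [val_rot_rot, val_rot_rot, e]
    split_ifs <;> omega

theorem Step.flip_iff {L n : ℕ} {i : ℕ} (hi : i + 1 < L) {B B' : Matrix (Fin L) (Fin n) Bool} :
    Step (L - 2 - i) (rot (rot B')) (rot (rot B)) ↔ Step i B B' := by
  refine ⟨fun h => ?_, Step.flip⟩
  have := h.flip
  rwa [rot_rot_rot_rot, rot_rot_rot_rot, show L - 2 - (L - 2 - i) = i by omega] at this

theorem Step.injective {L n : ℕ} {i : ℕ} {B B₁ B₂ : Matrix (Fin L) (Fin n) Bool}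
    (h₁ : Step i B₁ B) (h₂ : Step i B₂ B) : B₁ = B₂ := by
  have := h₁.flip.functional h₂.flip
  rw [← rot_rot_rot_rot B₁, this, rot_rot_rot_rot]

/-! ### Steps between columns -/

/-- The elementary step that moves a ball from column `j + 1` to column `j`. -/
def ColStep {L n : ℕ} (j : ℕ) (X Y : Matrix (Fin L) (Fin n) Bool) : Prop :=
  Step j (rot X) (rot Y)

/-- The height of the columns `j + 1` and `j` above the boundary `r`. -/
def colHt {L n : ℕ} (X : Matrix (Fin L) (Fin n) Bool) (j r : ℕ) : ℤ :=
  ht (rot X) j (L - r)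

theorem colHt_eq {L n : ℕ} (X : Matrix (Fin L) (Fin n) Bool) (j r : ℕ) :
    colHt X j r = colHt X j (r + 1) + (val X r (j + 1) - val X r j) := by
  unfold colHt
  by_cases h : r < L
  · rw [show L - r = L - (r + 1) + 1 by omega, ht_succ, val_rot, val_rot, if_pos (by omega),
      if_pos (by omega), show L - 1 - (L - (r + 1)) = r by omega]
  · rw [show L - r = 0 by omega, show L - (r + 1) = 0 by omega, val_row_of_le _ _ (by omega),
      val_row_of_le _ _ (by omega)]
    simp

theorem colHt_of_le {L n : ℕ} (X : Matrix (Fin L) (Fin n) Bool) (j : ℕ) {r : ℕ} (h : L ≤ r) :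
    colHt X j r = 0 := by
  unfold colHt
  rw [show L - r = 0 by omega, ht_zero]

theorem colStep_iff {L n : ℕ} {j : ℕ} {X Y : Matrix (Fin L) (Fin n) Bool} :
    ColStep j X Y ↔ ∃ q, val X q (j + 1) = 1 ∧ val X q j = 0 ∧
      (∀ r, q < r → colHt X j (q + 1) ≤ colHt X j r) ∧
      (∀ r, r ≤ q → colHt X j (q + 1) < colHt X j r) ∧
      ∀ r c, val Y r c = val X r c +
        if r = q then (if c = j then 1 else 0) - (if c = j + 1 then 1 else 0) else 0 := by
  constructor
  · rintro ⟨y, ⟨h1, h2, h3, h4⟩, e⟩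
    have hy : y < L := by
      by_contra hh
      rw [val_col_of_le _ _ (by omega)] at h1; omega
    refine ⟨L - 1 - y, ?_, ?_, ?_, ?_, ?_⟩
    · rwa [val_rot, if_pos hy] at h1
    · rwa [val_rot, if_pos hy] at h2
    · intro r hr
      unfold colHt
      rw [show L - (L - 1 - y + 1) = y by omega]
      exact h3 _ (by omega)
    · intro r hr
      unfold colHt
      rw [show L - (L - 1 - y + 1) = y by omega]
      exact h4 _ (by omega)
    · intro r c
      by_cases hr : r < L
      · have := e c (L - 1 - r)
        rw [val_rot, val_rot, if_pos (by omega), if_pos (by omega),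
          show L - 1 - (L - 1 - r) = r by omega] at this
        rw [this]
        split_ifs <;> omega
      · rw [val_row_of_le _ _ (by omega), val_row_of_le _ _ (by omega)]
        split_ifs <;> omega
  · rintro ⟨q, h1, h2, h3, h4, e⟩
    have hq : q < L := by
      by_contra hh
      rw [val_row_of_le _ _ (by omega)] at h1; omega
    have hht : ht (rot X) j (L - 1 - q) = colHt X j (q + 1) := by
      unfold colHt; congr 1; omega
    refine ⟨L - 1 - q, ⟨?_, ?_, ?_, ?_⟩, ?_⟩
    · rwa [val_rot, if_pos (by omega), show L - 1 - (L - 1 - q) = q by omega]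
    · rwa [val_rot, if_pos (by omega), show L - 1 - (L - 1 - q) = q by omega]
    · intro x hx
      have := h3 (L - x) (by omega)
      rw [hht]
      unfold colHt at this ⊢
      rwa [show L - (L - x) = x by omega] at this
    · intro x hx
      rw [hht]
      by_cases hxL : x ≤ L
      · have := h4 (L - x) (by omega)
        unfold colHt at this ⊢
        rwa [show L - (L - x) = x by omega] at this
      · have := h4 0 (by omega)
        have hx' : ∀ d, ht (rot X) j (L + d) = ht (rot X) j L := by
          intro d
          induction d with
          | zero => rfl
          | succ d ih =>
            rw [← add_assoc, ht_succ, ih, val_col_of_le _ _ (by omega),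
              val_col_of_le _ _ (by omega)]
            simp
        have e2 := hx' (x - L)
        rw [show L + (x - L) = x by omega] at e2
        rw [e2]
        exact this
    · intro c k
      rw [val_rot, val_rot, e]
      split_ifs <;> omega

theorem ht_of_colStep {L n : ℕ} {q j : ℕ} {X Y : Matrix (Fin L) (Fin n) Bool}
    (e : ∀ r c, val Y r c = val X r c +
        if r = q then (if c = j then 1 else 0) - (if c = j + 1 then 1 else 0) else 0) (i x : ℕ) :
    ht Y i x = ht X i x +
      if x = j + 1 then (if i + 1 = q then 1 else 0) - (if i = q then 1 else 0) else 0 := by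
  induction x with
  | zero => simp [ht_zero]
  | succ x ih =>
    rw [ht_succ, ht_succ, ih, e, e]
    split_ifs <;> omega

theorem colHt_of_step {L n : ℕ} {i p : ℕ} {B B' : Matrix (Fin L) (Fin n) Bool}
    (hi : i + 1 < L) (e : ∀ r c, val B' r c =
      val B r c + if c = p then (if r = i then 1 else 0) - (if r = i + 1 then 1 else 0) else 0)
    (j r : ℕ) : colHt B' j r = colHt B j r +
      if r = i + 1 then (if j = p then 1 else 0) - (if j + 1 = p then 1 else 0) else 0 := by
  by_cases hr : r ≤ L
  · obtain ⟨d, hd⟩ := Nat.exists_eq_add_of_le hr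
    induction d generalizing r with
    | zero =>
      rw [colHt_of_le _ _ (by omega), colHt_of_le _ _ (by omega)]
      split_ifs <;> omega
    | succ d ih =>
      rw [colHt_eq, colHt_eq B, ih (r + 1) (by omega) (by omega), e, e]
      split_ifs <;> omega
  · rw [colHt_of_le _ _ (by omega), colHt_of_le _ _ (by omega), if_neg (by omega)]
    rfl

theorem val_bounds {L n : ℕ} (X : Matrix (Fin L) (Fin n) Bool) (r c : ℕ) :
    0 ≤ val X r c ∧ val X r c ≤ 1 := by
  have := val_eq_zero_or_one X r c
  omega

theorem Step.exists_of_isLeftmost {L n : ℕ} {i p : ℕ} {B : Matrix (Fin L) (Fin n) Bool}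
    (h : IsLeftmost i p B) : ∃ B', Step i B B' ∧ ∀ r c, val B' r c =
      val B r c + if c = p then (if r = i then 1 else 0) - (if r = i + 1 then 1 else 0) else 0 := by
  obtain ⟨B', hB⟩ := h.exists_step
  refine ⟨B', hB, ?_⟩
  obtain ⟨p', hp', e⟩ := hB
  obtain rfl := h.unique hp'
  exact e

set_option maxHeartbeats 1600000 in
-- The two steps interact only in the block of rows `i`, `i + 1` and columns `j`, `j + 1`: a column
-- step changes the row height only at the boundary `j + 1`, and a row step changes the column
-- height only at the boundary `i + 1`, each by at most 1. Hence each step keeps its position after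
-- the other one, except when both want the same ball or the same vacancy.
theorem Step.diamond {L n : ℕ} {i j : ℕ} {X X' Y : Matrix (Fin L) (Fin n) Bool}
    (hR : Step i X X') (hC : ColStep j X Y) : ∃ Y', Step i Y Y' ∧ ColStep j X' Y' := by
  have hi := hR.lt
  obtain ⟨p, ⟨a1, a2, a3, a4⟩, e⟩ := hR
  obtain ⟨q, b1, b2, b3, b4, f⟩ := colStep_iff.1 hC
  have hH := ht_of_colStep f
  have hV := colHt_of_step hi e
  have u00 := val_bounds X i j
  have u01 := val_bounds X i (j + 1)
  have u10 := val_bounds X (i + 1) j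
  have u11 := val_bounds X (i + 1) (j + 1)
  have v00 := val_bounds X i p
  have v01 := val_bounds X i (p + 1)
  have v10 := val_bounds X (i + 1) p
  have v11 := val_bounds X (i + 1) (p + 1)
  have s1 := ht_succ X i j
  have s2 := ht_succ X i (j + 1)
  have t1 := colHt_eq X j i
  have t2 := colHt_eq X j (i + 1)
  have g3 := a3 j
  have g4 := a4 j
  have g5 := a3 (j + 1 + 1)
  have g6 := a4 (j + 1 + 1)
  have k1 := b3 (i + 1 + 1)
  have k2 := b4 (i + 1 + 1)
  have k3 := b3 i
  have k4 := b4 i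
  have g7 := a3 (j + 1)
  have g8 := a4 (j + 1)
  have k5 := b3 (i + 1)
  have k6 := b4 (i + 1)
  -- Both steps want the ball in the upper right corner of the block. In either order this ball
  -- travels to the lower left corner, so the second step acts at column `j`, respectively row `i`.
  by_cases hA : q = i + 1 ∧ p = j + 1
  · obtain ⟨rfl, rfl⟩ := hA
    obtain ⟨Y', hY', e'⟩ := Step.exists_of_isLeftmost (B := Y) (i := i) (p := j) (by
      refine ⟨?_, ?_, ?_, ?_⟩
      · rw [f]; simp; omega
      · rw [f]; simp; omega
      · intro x hx
        have := a3 x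
        rw [hH, hH]; split_ifs <;> subst_vars <;> omega
      · intro x hx
        have := a4 x
        rw [hH, hH]; split_ifs <;> subst_vars <;> omega)
    refine ⟨Y', hY', colStep_iff.2 ⟨i, ?_, ?_, ?_, ?_, ?_⟩⟩
    · rw [e]; simp; omega
    · rw [e]; simp; omega
    · intro r hr
      have := b3 r
      rw [hV, hV]; split_ifs <;> subst_vars <;> omega
    · intro r hr
      have := b4 r
      rw [hV, hV]; split_ifs <;> subst_vars <;> omega
    · intro r c
      rw [e', f, e]
      split_ifs <;> omega
  -- Both steps want to fill the lower left corner. Strictness of the minimum at `p` forces a ball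
  -- in the upper right corner, and this is the ball moved by whichever step comes second.
  by_cases hB : q = i ∧ p = j
  · obtain ⟨rfl, rfl⟩ := hB
    obtain ⟨Y', hY', e'⟩ := Step.exists_of_isLeftmost (B := Y) (i := q) (p := p + 1) (by
      refine ⟨?_, ?_, ?_, ?_⟩
      · rw [f]; simp; omega
      · rw [f]; simp; omega
      · intro x hx
        have := a3 x
        have := a4 x
        rw [hH, hH]; split_ifs <;> subst_vars <;> omega
      · intro x hx
        have := a4 x
        rw [hH, hH]; split_ifs <;> subst_vars <;> omega)
    refine ⟨Y', hY', colStep_iff.2 ⟨q + 1, ?_, ?_, ?_, ?_, ?_⟩⟩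
    · rw [e]; simp; omega
    · rw [e]; simp; omega
    · intro r hr
      have := b3 r
      rw [hV, hV]; split_ifs <;> subst_vars <;> omega
    · intro r hr
      have := b4 r
      have := b3 r
      rw [hV, hV]; split_ifs <;> subst_vars <;> omega
    · intro r c
      rw [e', f, e]
      split_ifs <;> omega
  -- The mixed cases would need one entry of the block to be both a ball and a vacancy.
  have c1 : q = i → p ≠ j + 1 := by rintro rfl rfl; omega
  have c2 : q = i + 1 → p ≠ j := by rintro rfl rfl; omega
  obtain ⟨Y', hY', e'⟩ := Step.exists_of_isLeftmost (B := Y) (i := i) (p := p) (by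
    refine ⟨?_, ?_, ?_, ?_⟩
    · rw [f]; split_ifs <;> omega
    · rw [f]; split_ifs <;> omega
    · intro x hx
      have := a3 x
      rw [hH, hH]
      by_cases hq : q = i
      · subst hq
        split_ifs <;> subst_vars <;> omega
      · split_ifs <;> omega
    · intro x hx
      have := a4 x
      rw [hH, hH]
      by_cases hq : q = i
      · subst hq
        split_ifs <;> subst_vars <;> omega
      · split_ifs <;> omega)
  refine ⟨Y', hY', colStep_iff.2 ⟨q, ?_, ?_, ?_, ?_, ?_⟩⟩
  · rw [e]; split_ifs <;> omega
  · rw [e]; split_ifs <;> omega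
  · intro r hr
    have := b3 r
    rw [hV, hV]
    by_cases hp : p = j + 1
    · subst hp
      split_ifs <;> subst_vars <;> omega
    · split_ifs <;> omega
  · intro r hr
    have := b4 r
    rw [hV, hV]
    by_cases hp : p = j + 1
    · subst hp
      split_ifs <;> subst_vars <;> omega
    · split_ifs <;> omega
  · intro r c
    rw [e', f, e]
    ring

/-- Rotation by 180 degrees reverses all steps, and rotation by 90 degrees exchanges row and column
steps. The completions of a square from its other three corners are therefore rotated copies of
`Step.diamond`. -/
theorem Step.diamond_of_left {L n : ℕ} {i j : ℕ} {X Y Y' : Matrix (Fin L) (Fin n) Bool}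
    (hR : Step i Y Y') (hC : ColStep j X Y) : ∃ X', Step i X X' ∧ ColStep j X' Y' := by
  have h1 : ColStep i (rot (rot (rot Y))) (rot (rot (rot Y'))) := by
    unfold ColStep
    rwa [rot_rot_rot_rot, rot_rot_rot_rot]
  obtain ⟨W, hW, hW'⟩ := (Step.flip hC).diamond h1
  refine ⟨rot W, ?_, ?_⟩
  · unfold ColStep at hW'
    rwa [rot_rot_rot_rot] at hW'
  · unfold ColStep
    rw [← Step.flip_iff (Step.lt hC), rot_rot_rot_rot]
    exact hW

theorem Step.diamond_of_right {L n : ℕ} {i j : ℕ} {X' Y Y' : Matrix (Fin L) (Fin n) Bool}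
    (hR : Step i Y Y') (hC : ColStep j X' Y') : ∃ X, Step i X X' ∧ ColStep j X Y := by
  obtain ⟨W, hW, hW'⟩ := hR.flip.diamond (Y := rot (rot X')) (j := n - 2 - j) (Step.flip hC)
  refine ⟨rot (rot W), ?_, ?_⟩
  · rw [← Step.flip_iff hR.lt, rot_rot_rot_rot]
    exact hW
  · unfold ColStep
    rw [← Step.flip_iff (Step.lt hC)]
    unfold ColStep at hW'
    rwa [rot_rot_rot_rot]

theorem Step.diamond_of_below {L n : ℕ} {i j : ℕ} {X X' Y' : Matrix (Fin L) (Fin n) Bool}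
    (hR : Step i X X') (hC : ColStep j X' Y') : ∃ Y, Step i Y Y' ∧ ColStep j X Y := by
  obtain ⟨W, hW, hW'⟩ := Step.diamond (i := j) (j := L - 2 - i) (Y := rot X) hC hR.flip
  refine ⟨rot (rot (rot W)), ?_, ?_⟩
  · rw [← Step.flip_iff hR.lt, rot_rot_rot_rot]
    exact hW'
  · unfold ColStep
    rwa [rot_rot_rot_rot]

/-! ### The dropping operator in terms of heights -/

/-- The stack holds the columns whose height lies strictly below all later heights seen so far. The
heights of its entries are consecutive integers, starting from `H k - 1` at the top; this second
invariant shows that a fall of the height by 1 disqualifies exactly the top entry, which is the one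
that is popped. -/
theorem openStack_take {n : ℕ} (A C : Finset (Fin n)) (H : ℕ → ℤ)
    (hH : ∀ c : Fin n, H (c + 1) = H c + (if c ∈ A then 1 else 0) - (if c ∈ C then 1 else 0))
    (k : ℕ) (hk : k ≤ n) (s : List (Fin n))
    (hs : s = ((List.finRange n).take k).foldl (fun s c =>
      let s' := if c ∈ A then c :: s else s
      if c ∈ C then s'.tail else s') []) :
    (∀ c : Fin n, c ∈ s ↔ (c : ℕ) < k ∧ ∀ x, (c : ℕ) < x → x ≤ k → H c < H x) ∧
      ∀ m (hm : m < s.length), H (s[m] : Fin n) = H k - 1 - m := by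
  induction k generalizing s with
  | zero => subst hs; simp
  | succ k ih =>
    obtain ⟨ih1, ih2⟩ := ih (by omega) _ rfl
    have hlen : k < (List.finRange n).length := by simp; omega
    rw [List.take_add_one, List.getElem?_eq_getElem hlen, Option.toList_some,
      List.foldl_append] at hs
    generalize List.foldl _ _ (List.take k _) = t at ih1 ih2 hs
    have hkn : k < n := by omega
    have hHk := hH ⟨k, hkn⟩
    simp only [List.getElem_finRange, List.foldl_cons, List.foldl_nil, Fin.cast_mk] at hs
    have key : ∀ c : Fin n, ((c : ℕ) < k + 1 ∧ ∀ x, (c : ℕ) < x → x ≤ k + 1 → H c < H x) ↔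
        (c ∈ t ∧ H c < H (k + 1)) ∨ ((c : ℕ) = k ∧ H k < H (k + 1)) := by
      intro c
      rw [ih1]
      constructor
      · rintro ⟨h1, h2⟩
        rcases Nat.lt_or_ge c k with h | h
        · exact Or.inl ⟨⟨h, fun x hx hx' => h2 x hx (by omega)⟩, h2 _ (by omega) le_rfl⟩
        · have hc : (c : ℕ) = k := by omega
          exact Or.inr ⟨hc, by have := h2 (k + 1) (by omega) le_rfl; rwa [hc] at this⟩
      · rintro (⟨⟨h1, h2⟩, h3⟩ | ⟨h1, h2⟩)
        · refine ⟨by omega, fun x hx hx' => ?_⟩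
          rcases Nat.lt_or_ge k x with h | h
          · obtain rfl : x = k + 1 := by omega
            exact h3
          · exact h2 x hx h
        · refine ⟨by omega, fun x hx hx' => ?_⟩
          obtain rfl : x = k + 1 := by omega
          rwa [h1]
    have ht : ∀ c ∈ t, H c < H k := by
      intro c hc
      obtain ⟨m, hm, rfl⟩ := List.getElem_of_mem hc
      rw [ih2]; omega
    -- With balls in both rows, the column is pushed and popped at once, because the opening
    -- parenthesis is written first.
    by_cases hA : (⟨k, hkn⟩ : Fin n) ∈ A <;> by_cases hC : (⟨k, hkn⟩ : Fin n) ∈ C <;>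
      simp only [hA, hC, if_true, if_false, List.tail_cons] at hs hHk <;> subst hs
    · constructor
      · intro c
        rw [key]
        constructor
        · intro h
          exact Or.inl ⟨h, by have := ht c h; omega⟩
        · rintro (h | h)
          · exact h.1
          · omega
      · intro m hm
        rw [ih2]; omega
    · constructor
      · intro c
        rw [key, List.mem_cons, Fin.ext_iff]
        constructor
        · rintro (h | h)
          · exact Or.inr ⟨h, by omega⟩
          · exact Or.inl ⟨h, by have := ht c h; omega⟩
        · rintro (h | h)
          · exact Or.inr h.1
          · exact Or.inl h.1
      · intro m hm
        cases m with
        | zero => simp; omega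
        | succ m =>
          simp only [List.getElem_cons_succ]
          rw [ih2]; push_cast; omega
    · constructor
      · intro c
        rw [key]
        cases t with
        | nil =>
          simp; omega
        | cons a t =>
          have ha := ih2 0 (by simp)
          simp only [List.getElem_cons_zero] at ha
          rw [List.tail_cons, List.mem_cons]
          constructor
          · intro h
            refine Or.inl ⟨Or.inr h, ?_⟩
            obtain ⟨m, hm, rfl⟩ := List.getElem_of_mem h
            have := ih2 (m + 1) (by simpa using hm)
            simp only [List.getElem_cons_succ] at this
            rw [this]; push_cast; omega
          · rintro (⟨rfl | h, h2⟩ | h)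
            · push_cast at ha; omega
            · exact h
            · omega
      · intro m hm
        rw [List.getElem_tail, ih2]; push_cast; omega
    · constructor
      · intro c
        rw [key]
        constructor
        · intro h
          exact Or.inl ⟨h, by have := ht c h; omega⟩
        · rintro (h | h)
          · exact h.1
          · omega
      · intro m hm
        rw [ih2]; omega

theorem mem_unmatchedAbove_iff {n : ℕ} {A C : Finset (Fin n)} {H : ℕ → ℤ}
    (hH : ∀ c : Fin n, H (c + 1) = H c + (if c ∈ A then 1 else 0) - (if c ∈ C then 1 else 0))
    (c : Fin n) :
    c ∈ unmatchedAbove A C ↔ ∀ x, (c : ℕ) < x → x ≤ n → H c < H x := by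
  have := (openStack_take A C H hH n le_rfl (openStack A C) (by
    rw [List.take_of_length_le (by simp)]; rfl)).1 c
  rw [unmatchedAbove, List.mem_toFinset, this]
  simp

theorem mem_rowSet {L n : ℕ} {B : Matrix (Fin L) (Fin n) Bool} {r : ℕ} {c : Fin n} :
    c ∈ rowSet B r ↔ val B r c = 1 := by
  unfold rowSet val
  simp

theorem val_eq_ite {L n : ℕ} (B : Matrix (Fin L) (Fin n) Bool) (r : ℕ) (c : Fin n) :
    val B r c = if c ∈ rowSet B r then 1 else 0 := by
  have h1 := val_eq_zero_or_one B r c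
  split_ifs with h <;> rw [mem_rowSet] at h <;> omega

/-- The columns of the balls of row `i + 1` that are unmatched above. -/
def unmatched {L n : ℕ} (B : Matrix (Fin L) (Fin n) Bool) (i : ℕ) : Finset (Fin n) :=
  unmatchedAbove (rowSet B (i + 1)) (rowSet B i)

theorem ht_of_le {L n : ℕ} (B : Matrix (Fin L) (Fin n) Bool) (i : ℕ) {x : ℕ} (h : n ≤ x) :
    ht B i x = ht B i n := by
  obtain ⟨d, rfl⟩ := Nat.exists_eq_add_of_le h
  induction d with
  | zero => rfl
  | succ d ih =>
    rw [← add_assoc, ht_succ, ih (by omega), val_col_of_le _ _ (by omega),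
      val_col_of_le _ _ (by omega)]
    simp

theorem mem_unmatched {L n : ℕ} {B : Matrix (Fin L) (Fin n) Bool} {i : ℕ} {c : Fin n} :
    c ∈ unmatched B i ↔ ∀ x, (c : ℕ) < x → ht B i c < ht B i x := by
  rw [unmatched, mem_unmatchedAbove_iff (H := ht B i)]
  · constructor
    · intro h x hx
      rcases le_total x n with h' | h'
      · exact h x hx h'
      · rw [ht_of_le _ _ h']
        exact h n c.2 le_rfl
    · exact fun h x hx _ => h x hx
  · intro c
    rw [ht_succ, val_eq_ite, val_eq_ite]
    ring

theorem val_of_mem_unmatched {L n : ℕ} {B : Matrix (Fin L) (Fin n) Bool} {i : ℕ} {c : Fin n}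
    (h : c ∈ unmatched B i) : val B (i + 1) c = 1 ∧ val B i c = 0 := by
  have h1 := mem_unmatched.1 h (c + 1) (by omega)
  rw [ht_succ] at h1
  have := val_bounds B (i + 1) c
  have := val_bounds B i c
  omega

theorem lt_of_mem_unmatched {L n : ℕ} {B : Matrix (Fin L) (Fin n) Bool} {i : ℕ} {c : Fin n}
    (h : c ∈ unmatched B i) : i + 1 < L := by
  by_contra hh
  have := (val_of_mem_unmatched h).1
  rw [val_row_of_le _ _ (by omega)] at this
  omega

theorem val_dropStar {L n : ℕ} (B : Matrix (Fin L) (Fin n) Bool) (i r : ℕ) (c : Fin n) :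
    val (dropStar i B) r c = val B r c +
      if c ∈ unmatched B i then (if r = i then 1 else 0) - (if r = i + 1 then 1 else 0) else 0 := by
  have hv : c ∈ unmatched B i → val B (i + 1) c = 1 ∧ val B i c = 0 := val_of_mem_unmatched
  have hL : c ∈ unmatched B i → i + 1 < L := lt_of_mem_unmatched
  by_cases hr : r < L
  · have e1 := val_fin (dropStar i B) ⟨r, hr⟩ c
    have e2 := val_fin B ⟨r, hr⟩ c
    simp only [dropStar] at e1 e2
    change val (dropStar i B) r c = if (if r = i + 1 then B ⟨r, hr⟩ c && !decide (c ∈ unmatched B i)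
      else if r = i then B ⟨r, hr⟩ c || decide (c ∈ unmatched B i) else B ⟨r, hr⟩ c) = true
      then 1 else 0 at e1
    by_cases hc : c ∈ unmatched B i
    · obtain ⟨h1, h2⟩ := hv hc
      by_cases hr1 : r = i + 1
      · subst hr1
        simp [hc, h1, e1]
      · by_cases hr2 : r = i
        · subst hr2
          simp [hc, h2, e1]
        · simp [hr1, hr2, e1, e2]
    · simp [hc, e1, e2]
  · rw [val_row_of_le _ _ (by omega), val_row_of_le _ _ (by omega)]
    split_ifs with h1 <;> first | rfl | (have := hL h1; omega)

theorem dropStar_of_unmatched_eq_empty {L n : ℕ} {B : Matrix (Fin L) (Fin n) Bool} {i : ℕ}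
    (h : unmatched B i = ∅) : dropStar i B = B := by
  refine ext_val fun r c => ?_
  by_cases hc : c < n
  · have := val_dropStar B i r ⟨c, hc⟩
    simpa [h] using this
  · rw [val_col_of_le _ _ (by omega), val_col_of_le _ _ (by omega)]

theorem exists_last_min {L n : ℕ} (B : Matrix (Fin L) (Fin n) Bool) (i : ℕ) :
    ∃ p ≤ n, (∀ x, ht B i p ≤ ht B i x) ∧ ∀ x, p < x → x ≤ n → ht B i p < ht B i x := by
  obtain ⟨t, ht0, htmin⟩ := Finset.exists_min_image (Finset.range (n + 1)) (fun x =>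
    ht B i x) ⟨0, by simp⟩
  -- Positions are written as `n - t`, so that the least `t` gives the last minimum.
  have hex : ∃ t, t ≤ n ∧ ∀ x, ht B i (n - t) ≤ ht B i x := by
    refine ⟨n - t, by omega, fun x => ?_⟩
    have htn : t ≤ n := by simpa [Nat.lt_succ_iff] using ht0
    rw [show n - (n - t) = t by omega]
    rcases le_total x n with h | h
    · exact htmin x (by simp; omega)
    · rw [ht_of_le _ _ h]
      exact htmin n (by simp)
  classical
  obtain ⟨h1, h2⟩ := Nat.find_spec hex
  refine ⟨n - Nat.find hex, by omega, h2, fun x hx hxn => ?_⟩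
  by_contra hcon
  refine Nat.find_min hex (m := n - x) (by omega) ⟨by omega, fun y => ?_⟩
  rw [show n - (n - x) = x by omega]
  exact (not_lt.1 hcon).trans (h2 y)

/-- If the height is not minimal at the right end, it must rise right after its last minimum, which
forces a ball above a vacancy there. -/
theorem exists_isLeftmost {L n : ℕ} {B : Matrix (Fin L) (Fin n) Bool} {i x : ℕ}
    (hx : ht B i x < ht B i n) : ∃ p, IsLeftmost i p B := by
  obtain ⟨p, hp, h2, h3⟩ := exists_last_min B i
  have hpn : p < n := by
    by_contra hge
    obtain rfl : p = n := by omega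
    have := h2 x
    omega
  have h3' : ∀ x, p < x → ht B i p < ht B i x := by
    intro x hx
    rcases le_total x n with h | h
    · exact h3 x hx h
    · rw [ht_of_le _ _ h]
      exact h3 n hpn le_rfl
  have h4 := h3' (p + 1) (by omega)
  rw [ht_succ] at h4
  have := val_bounds B (i + 1) p
  have := val_bounds B i p
  exact ⟨p, by omega, by omega, fun x _ => h2 x, h3'⟩

theorem IsLeftmost.mem_unmatched {L n : ℕ} {B : Matrix (Fin L) (Fin n) Bool} {i p : ℕ}
    (h : IsLeftmost i p B) : ∃ hp : p < n, (⟨p, hp⟩ : Fin n) ∈ unmatched B i := by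
  obtain ⟨h1, -, -, h4⟩ := h
  have hp : p < n := by
    by_contra hh
    rw [val_col_of_le _ _ (by omega)] at h1; omega
  exact ⟨hp, MLQueue.mem_unmatched.2 h4⟩

theorem unmatched_eq_empty_iff {L n : ℕ} {B : Matrix (Fin L) (Fin n) Bool} {i : ℕ} :
    unmatched B i = ∅ ↔ ∀ x, ht B i n ≤ ht B i x := by
  constructor
  · intro h x
    by_contra hx
    obtain ⟨p, hp⟩ := exists_isLeftmost (not_le.1 hx)
    obtain ⟨hp', hm⟩ := hp.mem_unmatched
    rw [h] at hm
    exact Finset.notMem_empty _ hm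
  · intro h
    refine Finset.eq_empty_of_forall_notMem fun c hc => ?_
    have h1 := mem_unmatched.1 hc n c.2
    have h2 := h c
    omega

theorem exists_step_iff {L n : ℕ} {B : Matrix (Fin L) (Fin n) Bool} {i : ℕ} :
    (∃ B', Step i B B') ↔ (unmatched B i).Nonempty := by
  constructor
  · rintro ⟨B', p, hp, -⟩
    exact ⟨_, hp.mem_unmatched.2⟩
  · rintro ⟨u, hu⟩
    obtain ⟨p, hp⟩ := exists_isLeftmost (mem_unmatched.1 hu n u.2)
    exact hp.exists_step

/-- All heights to the right of `p` fall by the same amount, so comparisons among them persist.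
Columns to the left of `p` were matched before, since the height is minimal at `p`, and remain so.
-/
theorem Step.unmatched_eq {L n : ℕ} {B B' : Matrix (Fin L) (Fin n) Bool} {i : ℕ}
    (h : Step i B B') : ∃ p ∈ unmatched B i, unmatched B' i = (unmatched B i).erase p ∧
      ∀ r c, val B' r c = val B r c +
        if c = (p : ℕ) then (if r = i then 1 else 0) - (if r = i + 1 then 1 else 0) else 0 := by
  obtain ⟨p, ⟨h1, h2, h3, h4⟩, e⟩ := h
  have hp : p < n := by
    by_contra hh
    rw [val_col_of_le _ _ (by omega)] at h1; omega
  have hh := ht_of_step e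
  refine ⟨⟨p, hp⟩, mem_unmatched.2 h4, ?_, e⟩
  ext c
  rw [Finset.mem_erase, mem_unmatched, mem_unmatched, ne_eq, Fin.ext_iff]
  simp only [hh]
  have hs := ht_succ B i p
  have a1 := h3 c
  constructor
  · intro h
    have hcp : p < (c : ℕ) := by
      by_contra hcon
      have := h (p + 1) (by omega)
      split_ifs at this <;> omega
    refine ⟨by omega, fun x hx => ?_⟩
    have := h x hx
    split_ifs at this <;> omega
  · rintro ⟨hne, h⟩ x hx
    have := h x hx
    have hcp : p < (c : ℕ) := by
      by_contra hcon
      have := h p (by omega)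
      omega
    split_ifs <;> omega

theorem Step.dropStar_eq {L n : ℕ} {B B' : Matrix (Fin L) (Fin n) Bool} {i : ℕ}
    (h : Step i B B') : dropStar i B' = dropStar i B := by
  obtain ⟨p, hp, hU, e⟩ := h.unmatched_eq
  refine ext_val fun r c => ?_
  by_cases hc : c < n
  · have h1 := val_dropStar B i r ⟨c, hc⟩
    have h2 := val_dropStar B' i r ⟨c, hc⟩
    simp only [hU, Finset.mem_erase, ne_eq, Fin.ext_iff] at h1 h2
    rw [h1, h2, e]
    by_cases hcp : c = p
    · subst hcp
      simp [hp]
    · simp [hcp]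
  · rw [val_col_of_le _ _ (by omega), val_col_of_le _ _ (by omega)]

theorem unmatched_dropStar {L n : ℕ} (B : Matrix (Fin L) (Fin n) Bool) (i : ℕ) :
    unmatched (dropStar i B) i = ∅ := by
  induction hk : (unmatched B i).card generalizing B with
  | zero =>
    rw [Finset.card_eq_zero] at hk
    rw [dropStar_of_unmatched_eq_empty hk, hk]
  | succ k ih =>
    obtain ⟨B', hB'⟩ := exists_step_iff.2 (Finset.card_pos.1 (by omega : 0 < (unmatched B i).card))
    obtain ⟨p, hp, hU, -⟩ := hB'.unmatched_eq
    rw [← hB'.dropStar_eq]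
    exact ih B' (by rw [hU, Finset.card_erase_of_mem hp]; omega)

/-! ### Maximal strings of commuting partial operators -/

/-- `R` is a terminating partial injection and `d` sends every element to the end of the maximal
`R`-string through it. -/
structure IsDrop {α : Type*} (R : α → α → Prop) (d : α → α) : Prop where
  functional : ∀ {x y z}, R x y → R x z → y = z
  injective : ∀ {x y z}, R x z → R y z → x = y
  wf : WellFounded fun y x => R x y
  step : ∀ {x y}, R x y → d y = d x
  stuck : ∀ {x}, (∀ y, ¬R x y) → d x = x

/-- The map `T` is compatible with the partial injection `R`, in both directions. -/
structure Compatible {α : Type*} (R : α → α → Prop) (T : α → α) : Prop where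
  map : ∀ {x y}, R x y → R (T x) (T y)
  lift_right : ∀ {x y}, R (T x) y → ∃ x', R x x'
  lift_left : ∀ {x y}, R y (T x) → ∃ x', R x' x ∧ T x' = y

theorem IsDrop.string_induction {α : Type*} {R : α → α → Prop} {d : α → α} (hd : IsDrop R d)
    {P : α → Prop} (h0 : ∀ x, (∀ y, ¬R x y) → P x) (h1 : ∀ x y, R x y → P y → P x) (x : α) :
    P x := by
  induction x using hd.wf.induction with
  | _ x ih =>
    by_cases h : ∃ y, R x y
    · obtain ⟨y, hy⟩ := h
      exact h1 x y hy (ih y hy)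
    · exact h0 x fun y hy => h ⟨y, hy⟩

theorem Compatible.id {α : Type*} {R : α → α → Prop} : Compatible R (fun x => x) where
  map h := h
  lift_right h := ⟨_, h⟩
  lift_left h := ⟨_, h, rfl⟩

theorem Compatible.comp {α : Type*} {R : α → α → Prop} {T S : α → α} (hT : Compatible R T)
    (hS : Compatible R S) : Compatible R (fun x => T (S x)) where
  map h := hT.map (hS.map h)
  lift_right h := by
    obtain ⟨y, hy⟩ := hT.lift_right h
    exact hS.lift_right hy
  lift_left h := by
    obtain ⟨y, hy, e⟩ := hT.lift_left h
    obtain ⟨z, hz, rfl⟩ := hS.lift_left hy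
    exact ⟨z, hz, e⟩

theorem Compatible.stuck {α : Type*} {R : α → α → Prop} {T : α → α} (hT : Compatible R T) {x : α}
    (h : ∀ y, ¬R x y) (y : α) : ¬R (T x) y := fun hy => by
  obtain ⟨z, hz⟩ := hT.lift_right hy
  exact h z hz

/-- If the partial injections `R` and `C` commute, then running to the end of a `C`-string is
compatible with `R`. -/
theorem IsDrop.compatible {α : Type*} {R C : α → α → Prop} {c : α → α} (hc : IsDrop C c)
    -- The four hypotheses complete a square of `R`-steps and `C`-steps from its four corners `x`,
    -- `y`, `y'` and `x'`.
    (k1 : ∀ {x x' y}, R x x' → C x y → ∃ y', R y y' ∧ C x' y')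
    (k2 : ∀ {x y y'}, R y y' → C x y → ∃ x', R x x' ∧ C x' y')
    (k3 : ∀ {x' y y'}, R y y' → C x' y' → ∃ x, R x x' ∧ C x y)
    (k4 : ∀ {x x' y'}, R x x' → C x' y' → ∃ y, R y y' ∧ C x y) : Compatible R c where
  map {x} := by
    induction x using hc.string_induction with
    | h0 x hx =>
      intro x' h
      rw [hc.stuck hx, hc.stuck]
      · exact h
      · intro y' hy'
        obtain ⟨y, -, hy⟩ := k4 h hy'
        exact hx y hy
    | h1 x y hxy ih =>
      intro x' h
      obtain ⟨y', h1, h2⟩ := k1 h hxy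
      rw [← hc.step hxy, ← hc.step h2]
      exact ih h1
  lift_right {x} := by
    induction x using hc.string_induction with
    | h0 x hx =>
      intro y h
      rw [hc.stuck hx] at h
      exact ⟨y, h⟩
    | h1 x y hxy ih =>
      intro z h
      rw [← hc.step hxy] at h
      obtain ⟨y', hy'⟩ := ih h
      obtain ⟨x', hx', -⟩ := k2 hy' hxy
      exact ⟨x', hx'⟩
  lift_left {x} := by
    induction x using hc.string_induction with
    | h0 x hx =>
      intro y h
      rw [hc.stuck hx] at h
      refine ⟨y, h, hc.stuck fun z hz => ?_⟩
      obtain ⟨w, -, hw⟩ := k1 h hz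
      exact hx w hw
    | h1 x y hxy ih =>
      intro z h
      rw [← hc.step hxy] at h
      obtain ⟨y', hy', e⟩ := ih h
      obtain ⟨x', hx', hC⟩ := k3 hy' hxy
      exact ⟨x', hx', by rw [← hc.step hC, e]⟩

/-- The maps `T` and `W` commute, and every pair `(T B, W B)` of values that has the same image in
the common quotient comes from exactly one `B`. -/
structure Cartesian {α : Type*} (T W : α → α) : Prop where
  comm : ∀ x, T (W x) = W (T x)
  inj : ∀ {x y}, T x = T y → W x = W y → x = y
  lift : ∀ {p q}, T q = W p → ∃ b, W b = q ∧ T b = p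

theorem Cartesian.id {α : Type*} {T : α → α} : Cartesian T (fun x => x) where
  comm _ := rfl
  inj _ h := h
  lift h := ⟨_, rfl, h⟩

/-- This is the pasting of pullback squares. -/
theorem Cartesian.comp {α : Type*} {T W V : α → α} (hW : Cartesian T W) (hV : Cartesian T V) :
    Cartesian T (fun x => W (V x)) where
  comm x := by rw [hW.comm, hV.comm]
  inj h h' := hV.inj h (hW.inj (by rw [hV.comm, hV.comm, h]) h')
  lift h := by
    obtain ⟨b, hb, e⟩ := hW.lift h
    obtain ⟨a, rfl, e'⟩ := hV.lift e
    exact ⟨a, hb, e'⟩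

/-- A compatible `T` preserves the number of steps to the end of a string. Thus `x` is recovered
from the end `d x` by walking back as many steps as separate `T x` from its own end, and `lift_left`
guarantees that the walk is possible whenever it is possible in the image. -/
theorem IsDrop.cartesian {α : Type*} {R : α → α → Prop} {d T : α → α} (hd : IsDrop R d)
    (hT : Compatible R T) : Cartesian T d where
  comm x := by
    induction x using hd.string_induction with
    | h0 x hx => rw [hd.stuck hx, hd.stuck (hT.stuck hx)]
    | h1 x y hxy ih => rw [← hd.step hxy, ih, hd.step (hT.map hxy)]
  inj {x} := by
    induction x using hd.string_induction with
    | h0 x hx =>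
      intro y h h'
      have hy : ∀ z, ¬R y z := fun z hz => by
        have := hT.map hz
        rw [← h] at this
        exact hT.stuck hx _ this
      rwa [hd.stuck hx, hd.stuck hy] at h'
    | h1 x x' hx ih =>
      intro y h h'
      have h1 := hT.map hx
      rw [h] at h1
      obtain ⟨y', hy⟩ := hT.lift_right h1
      have h2 := hd.functional h1 (hT.map hy)
      have := ih h2 (by rw [hd.step hx, hd.step hy, h'])
      subst this
      exact hd.injective hx hy
  lift {p} := by
    induction p using hd.string_induction with
    | h0 p hp =>
      intro q h
      rw [hd.stuck hp] at h
      refine ⟨q, hd.stuck fun z hz => ?_, h⟩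
      have := hT.map hz
      rw [h] at this
      exact hp _ this
    | h1 p p' hp ih =>
      intro q h
      rw [← hd.step hp] at h
      obtain ⟨b', hb, e⟩ := ih h
      rw [← e] at hp
      obtain ⟨b, hb', e'⟩ := hT.lift_left hp
      exact ⟨b, by rw [← hd.step hb', hb], e'⟩

/-! ### The two collapsings -/

theorem isDrop_dropStar {L n : ℕ} (i : ℕ) :
    IsDrop (Step (L := L) (n := n) i) (dropStar i) where
  functional := Step.functional
  injective := Step.injective
  wf := by
    refine Subrelation.wf (r := InvImage (· < ·) fun B : Matrix (Fin L) (Fin n) Bool =>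
      (unmatched B i).card) ?_ (InvImage.wf _ wellFounded_lt)
    intro B' B h
    obtain ⟨p, hp, hU, -⟩ := Step.unmatched_eq h
    change (unmatched B' i).card < (unmatched B i).card
    rw [hU]
    exact Finset.card_erase_lt_of_mem hp
  step := Step.dropStar_eq
  stuck h := dropStar_of_unmatched_eq_empty (by
    by_contra hne
    obtain ⟨y, hy⟩ := exists_step_iff.2 (Finset.nonempty_iff_ne_empty.2 hne)
    exact h y hy)

/-- A map between matrices, applied to the rotated matrix. -/
def conjRot {L n : ℕ} (T : Matrix (Fin n) (Fin L) Bool → Matrix (Fin n) (Fin L) Bool)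
    (B : Matrix (Fin L) (Fin n) Bool) : Matrix (Fin L) (Fin n) Bool :=
  rotInv (T (rot B))

theorem rot_injective {L n : ℕ} : Function.Injective (rot (L := L) (n := n)) :=
  Function.LeftInverse.injective rotInv_rot

theorem isDrop_conjRot_dropStar {L n : ℕ} (j : ℕ) :
    IsDrop (ColStep (L := L) (n := n) j) (conjRot (dropStar j)) where
  functional h h' := rot_injective (Step.functional h h')
  injective h h' := rot_injective (Step.injective h h')
  wf := InvImage.wf rot (isDrop_dropStar (L := n) (n := L) j).wf
  step h := by rw [conjRot, conjRot, Step.dropStar_eq h]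
  stuck {x} h := by
    rw [conjRot, (isDrop_dropStar j).stuck, rotInv_rot]
    intro y hy
    refine h (rotInv y) ?_
    rw [ColStep, rot_rotInv]
    exact hy

theorem compatible_conjRot_dropStar {L n : ℕ} (i j : ℕ) :
    Compatible (Step (L := L) (n := n) i) (conjRot (dropStar j)) :=
  (isDrop_conjRot_dropStar j).compatible Step.diamond Step.diamond_of_left Step.diamond_of_right
    Step.diamond_of_below

/-- A property of maps that is stable under composition and holds for the dropping operators holds
for the collapsing. -/
theorem collapseRows_induction {L n : ℕ}
    {P : (Matrix (Fin L) (Fin n) Bool → Matrix (Fin L) (Fin n) Bool) → Prop}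
    (hid : P fun B => B) (hcomp : ∀ {f g}, P f → P g → P fun B => f (g B))
    (hdrop : ∀ i, P (dropStar i)) (k : ℕ) : P (collapseRows k) := by
  have hchain : ∀ b, P (dropChain b) := by
    intro b
    induction b with
    | zero => exact hdrop 0
    | succ b ih =>
      exact show P fun B => dropChain b (dropStar (b + 1) B) from hcomp ih (hdrop (b + 1))
  induction k with
  | zero => exact hid
  | succ k ih =>
    exact show P fun B => dropChain k (collapseRows k B) from hcomp (hchain k) ih

theorem rhoLeft_induction {L n : ℕ}
    {P : (Matrix (Fin L) (Fin n) Bool → Matrix (Fin L) (Fin n) Bool) → Prop}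
    (hid : P fun B => B) (hcomp : ∀ {f g}, P f → P g → P fun B => f (g B))
    (hdrop : ∀ i, P (conjRot (dropStar i))) : P rhoLeft := by
  refine collapseRows_induction (P := fun f => P (conjRot f)) ?_ ?_ hdrop (n - 1)
  · convert hid using 2
    exact rotInv_rot _
  · intro f g hf hg
    convert hcomp hf hg using 2
    simp [conjRot, rot_rotInv]

theorem compatible_rhoLeft {L n : ℕ} (i : ℕ) :
    Compatible (Step (L := L) (n := n) i) rhoLeft :=
  rhoLeft_induction Compatible.id Compatible.comp (compatible_conjRot_dropStar i)

/-- Leftward collapsing is a composite of column droppings, each compatible with all row steps;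
downward collapsing is a composite of row droppings, whose squares are pasted. -/
theorem cartesian_rhoLeft_rhoDown {L n : ℕ} :
    Cartesian (rhoLeft (L := L) (n := n)) rhoDown :=
  collapseRows_induction Cartesian.id Cartesian.comp
    (fun i => (isDrop_dropStar i).cartesian (compatible_rhoLeft i)) (L - 1)

/-! ### Collapsed matrices have no ball that is unmatched above -/

/-- The number of elements of `A` weakly to the right of column `x`. -/
def cardGe {n : ℕ} (A : Finset (Fin n)) (x : ℕ) : ℕ :=
  (A.filter fun c : Fin n => x ≤ (c : ℕ)).card

theorem cardGe_of_le {n : ℕ} (A : Finset (Fin n)) {x : ℕ} (h : n ≤ x) : cardGe A x = 0 := by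
  rw [cardGe, Finset.card_eq_zero, Finset.filter_eq_empty_iff]
  intro c _
  omega

theorem cardGe_step {n : ℕ} (A : Finset (Fin n)) {x : ℕ} (h : x < n) :
    cardGe A x = cardGe A (x + 1) + if (⟨x, h⟩ : Fin n) ∈ A then 1 else 0 := by
  unfold cardGe
  split_ifs with hx
  · rw [← Finset.card_insert_of_notMem (a := (⟨x, h⟩ : Fin n)) (by simp)]
    congr 1
    ext c
    rw [Finset.mem_insert, Finset.mem_filter, Finset.mem_filter, Fin.ext_iff]
    constructor
    · rintro ⟨h1, h2⟩
      by_cases hc : (c : ℕ) = x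
      · exact Or.inl hc
      · exact Or.inr ⟨h1, by omega⟩
    · rintro (h1 | ⟨h1, h2⟩)
      · obtain rfl : c = ⟨x, h⟩ := Fin.ext h1
        exact ⟨hx, le_rfl⟩
      · exact ⟨h1, by omega⟩
  · congr 1
    ext c
    rw [Finset.mem_filter, Finset.mem_filter]
    refine and_congr_right fun hc => ⟨fun h1 => ?_, fun h1 => by omega⟩
    rcases h1.lt_or_eq with h2 | rfl
    · exact h2
    · exact absurd hc hx

theorem cardGe_antitone {n : ℕ} (A : Finset (Fin n)) {x y : ℕ} (h : x ≤ y) :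
    cardGe A y ≤ cardGe A x :=
  Finset.card_le_card (Finset.monotone_filter_right _ fun c _ (hc : y ≤ (c : ℕ)) => h.trans hc)

theorem cardGe_union {n : ℕ} {A D : Finset (Fin n)} (h : Disjoint A D) (x : ℕ) :
    cardGe (A ∪ D) x = cardGe A x + cardGe D x := by
  unfold cardGe
  rw [Finset.filter_union, Finset.card_union_of_disjoint (Finset.disjoint_filter_filter h)]

theorem ht_sub_ht {L n : ℕ} (B : Matrix (Fin L) (Fin n) Bool) (i x : ℕ) :
    ht B i n - ht B i x = cardGe (rowSet B (i + 1)) x - cardGe (rowSet B i) x := by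
  by_cases hx : x ≤ n
  · obtain ⟨d, hd⟩ := Nat.exists_eq_add_of_le hx
    induction d generalizing x with
    | zero =>
      obtain rfl : n = x := hd
      simp [cardGe_of_le]
    | succ d ih =>
      have h1 := ih (x + 1) (by omega) (by omega)
      rw [ht_succ] at h1
      have hxn : x < n := by omega
      rw [cardGe_step _ hxn, cardGe_step _ hxn]
      have e1 := val_eq_ite B (i + 1) ⟨x, hxn⟩
      have e2 := val_eq_ite B i ⟨x, hxn⟩
      simp only at e1 e2
      push_cast
      rw [← e1, ← e2]
      omega
  · have hx' : n ≤ x := by omega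
    rw [ht_of_le _ _ hx', cardGe_of_le _ hx', cardGe_of_le _ hx', sub_self, sub_self]

theorem unmatched_eq_empty_iff_cardGe {L n : ℕ} {B : Matrix (Fin L) (Fin n) Bool} {i : ℕ} :
    unmatched B i = ∅ ↔ ∀ x, cardGe (rowSet B (i + 1)) x ≤ cardGe (rowSet B i) x := by
  rw [unmatched_eq_empty_iff]
  refine forall_congr' fun x => ?_
  have := ht_sub_ht B i x
  omega

/-- Scanned from the right, unmatched balls are the strict record lows of the height. Together with
`exists_cardGe_unmatched_le` this gives their number weakly right of `x` as the maximum of `ht B i n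
- ht B i y` over `y ≥ x`. -/
theorem ht_sub_ht_le_cardGe_unmatched {L n : ℕ} (B : Matrix (Fin L) (Fin n) Bool) (i : ℕ) {x : ℕ}
    (hx : x ≤ n) : ht B i n - ht B i x ≤ cardGe (unmatched B i) x := by
  induction hd : n - x using Nat.strong_induction_on generalizing x with
  | _ d ih =>
    rcases hx.lt_or_eq with h | rfl
    · by_cases hU : (⟨x, h⟩ : Fin n) ∈ unmatched B i
      · have h1 := ih (n - (x + 1)) (by omega) (x := x + 1) (by omega) rfl
        obtain ⟨h2, h3⟩ := val_of_mem_unmatched hU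
        simp only at h2 h3
        rw [ht_succ, h2, h3] at h1
        rw [cardGe_step _ h, if_pos hU]
        push_cast
        omega
      · rw [mem_unmatched] at hU
        push Not at hU
        obtain ⟨y, hy, hyx⟩ := hU
        simp only at hy hyx
        by_cases hyn : y ≤ n
        · have h1 := ih (n - y) (by omega) hyn rfl
          have h2 := cardGe_antitone (unmatched B i) hy.le
          omega
        · rw [ht_of_le _ _ (by omega : n ≤ y)] at hyx
          omega
    · simp

theorem exists_cardGe_unmatched_le {L n : ℕ} (B : Matrix (Fin L) (Fin n) Bool) (i : ℕ) {x : ℕ}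
    (hx : x ≤ n) : ∃ y, x ≤ y ∧ (cardGe (unmatched B i) x : ℤ) ≤ ht B i n - ht B i y := by
  obtain ⟨d, hd⟩ := Nat.exists_eq_add_of_le hx
  induction d generalizing x with
  | zero =>
    obtain rfl : n = x := hd
    exact ⟨n, le_rfl, by simp [cardGe_of_le]⟩
  | succ d ih =>
    obtain ⟨y, hy, h⟩ := ih (x := x + 1) (by omega) (by omega)
    have hxn : x < n := by omega
    rw [cardGe_step _ hxn]
    split_ifs with hU
    · have := mem_unmatched.1 hU y (by simp only; omega)
      simp only at this
      exact ⟨x, le_rfl, by push_cast; omega⟩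
    · exact ⟨y, by omega, by simpa using h⟩

theorem rowSet_dropStar_of_ne {L n : ℕ} (B : Matrix (Fin L) (Fin n) Bool) {i r : ℕ} (h : r ≠ i)
    (h' : r ≠ i + 1) : rowSet (dropStar i B) r = rowSet B r := by
  ext c
  rw [mem_rowSet, mem_rowSet, val_dropStar, if_neg h, if_neg h']
  simp

theorem rowSet_dropStar_union {L n : ℕ} (B : Matrix (Fin L) (Fin n) Bool) (i : ℕ) :
    rowSet (dropStar i B) (i + 1) ∪ unmatched B i = rowSet B (i + 1) ∧
      Disjoint (rowSet (dropStar i B) (i + 1)) (unmatched B i) := by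
  have key : ∀ c, c ∈ rowSet (dropStar i B) (i + 1) ↔ c ∈ rowSet B (i + 1) ∧ c ∉ unmatched B i := by
    intro c
    rw [mem_rowSet, mem_rowSet, val_dropStar]
    by_cases hc : c ∈ unmatched B i
    · simp [hc, (val_of_mem_unmatched hc).1]
    · simp [hc]
  constructor
  · ext c
    rw [Finset.mem_union, key]
    have : c ∈ unmatched B i → c ∈ rowSet B (i + 1) := fun hc =>
      mem_rowSet.2 (val_of_mem_unmatched hc).1
    tauto
  · rw [Finset.disjoint_left]
    intro c hc
    exact ((key c).1 hc).2

theorem rowSet_dropStar_self {L n : ℕ} (B : Matrix (Fin L) (Fin n) Bool) (i : ℕ) :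
    rowSet (dropStar i B) i = rowSet B i ∪ unmatched B i ∧
      Disjoint (rowSet B i) (unmatched B i) := by
  constructor
  · ext c
    rw [Finset.mem_union, mem_rowSet, mem_rowSet, val_dropStar]
    by_cases hc : c ∈ unmatched B i
    · simp [hc, (val_of_mem_unmatched hc).2]
    · simp [hc]
  · rw [Finset.disjoint_left]
    intro c hc hc'
    have := (val_of_mem_unmatched hc').2
    have := mem_rowSet.1 hc
    omega

theorem rowSet_dropChain {L n : ℕ} (b : ℕ) (B : Matrix (Fin L) (Fin n) Bool) :
    (∀ r, b + 1 < r → rowSet (dropChain b B) r = rowSet B r) ∧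
      rowSet (dropChain b B) (b + 1) = rowSet (dropStar b B) (b + 1) := by
  induction b generalizing B with
  | zero => exact ⟨fun r hr => rowSet_dropStar_of_ne B (by omega) (by omega), rfl⟩
  | succ b ih =>
    obtain ⟨h1, h2⟩ := ih (dropStar (b + 1) B)
    exact ⟨fun r hr => (h1 r (by omega)).trans (rowSet_dropStar_of_ne B (by omega) (by omega)),
      h1 (b + 1 + 1) (by omega)⟩

/-- Count weakly right of `x`. The excess of the top row over the middle row is at most the number
of balls entering the middle row. Since the middle row had no unmatched ball over the bottom row, at
most as many balls leave it as have entered. -/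
theorem cardGe_dropStar_dropStar {L n : ℕ} (B : Matrix (Fin L) (Fin n) Bool) {b : ℕ}
    (h : unmatched B b = ∅) (x : ℕ) :
    cardGe (rowSet (dropStar (b + 1) B) (b + 1 + 1)) x ≤
      cardGe (rowSet (dropStar b (dropStar (b + 1) B)) (b + 1)) x := by
  by_cases hx : x ≤ n
  · have h1 := ht_sub_ht_le_cardGe_unmatched B (b + 1) hx
    rw [ht_sub_ht] at h1
    obtain ⟨y, hy, h2⟩ := exists_cardGe_unmatched_le (dropStar (b + 1) B) b hx
    rw [ht_sub_ht, rowSet_dropStar_of_ne B (by omega : b ≠ b + 1) (by omega)] at h2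
    have h3 := unmatched_eq_empty_iff_cardGe.1 h y
    obtain ⟨e1, d1⟩ := rowSet_dropStar_union B (b + 1)
    have e1 := cardGe_union d1 x
    rw [(rowSet_dropStar_union B (b + 1)).1] at e1
    obtain ⟨e2, d2⟩ := rowSet_dropStar_self B (b + 1)
    have e3 := cardGe_union d2 x
    have e4 := cardGe_union d2 y
    rw [← e2] at e3 e4
    obtain ⟨e5, d5⟩ := rowSet_dropStar_union (dropStar (b + 1) B) b
    have e6 := cardGe_union d5 x
    rw [e5] at e6
    have h4 := cardGe_antitone (unmatched B (b + 1)) hy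
    omega
  · rw [cardGe_of_le _ (by omega)]
    omega

theorem unmatched_congr {L n : ℕ} {B B' : Matrix (Fin L) (Fin n) Bool} {i : ℕ}
    (h : rowSet B i = rowSet B' i) (h' : rowSet B (i + 1) = rowSet B' (i + 1)) :
    unmatched B i = unmatched B' i := by
  rw [unmatched, unmatched, h, h']

theorem unmatched_dropChain {L n : ℕ} (b : ℕ) (B : Matrix (Fin L) (Fin n) Bool)
    (h : ∀ i < b, unmatched B i = ∅) : ∀ i ≤ b, unmatched (dropChain b B) i = ∅ := by
  induction b generalizing B with
  | zero =>
    intro i hi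
    obtain rfl : i = 0 := by omega
    exact unmatched_dropStar B 0
  | succ b ih =>
    intro i hi
    rcases hi.lt_or_eq with h1 | rfl
    · refine ih (dropStar (b + 1) B) (fun i hi => ?_) i (by omega)
      rw [← h i (by omega)]
      exact unmatched_congr (rowSet_dropStar_of_ne B (by omega) (by omega))
        (rowSet_dropStar_of_ne B (by omega) (by omega))
    -- After the first two drops, the rest of the chain no longer touches the top two rows involved.
    · rw [unmatched_eq_empty_iff_cardGe]
      intro x
      obtain ⟨h1, h2⟩ := rowSet_dropChain b (dropStar (b + 1) B)
      rw [dropChain, h2, h1 _ (by omega)]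
      exact cardGe_dropStar_dropStar B (h b (by omega)) x

theorem unmatched_collapseRows {L n : ℕ} (k : ℕ) (B : Matrix (Fin L) (Fin n) Bool) :
    ∀ i < k, unmatched (collapseRows k B) i = ∅ := by
  induction k with
  | zero => intro i hi; omega
  | succ k ih => exact fun i hi => unmatched_dropChain k _ ih i (by omega)

theorem unmatched_rhoDown {L n : ℕ} (B : Matrix (Fin L) (Fin n) Bool) (i : ℕ) :
    unmatched (rhoDown B) i = ∅ := by
  by_cases h : i < L - 1
  · exact unmatched_collapseRows _ _ _ h
  · refine Finset.eq_empty_of_forall_notMem fun c hc => ?_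
    have := lt_of_mem_unmatched hc
    omega

theorem collapseRows_of_unmatched {L n : ℕ} {B : Matrix (Fin L) (Fin n) Bool}
    (h : ∀ i, unmatched B i = ∅) (k : ℕ) : collapseRows k B = B :=
  collapseRows_induction (P := fun f => f B = B) rfl
    (fun {f g} hf hg => by change f (g B) = B; rw [hg, hf])
    (fun i => dropStar_of_unmatched_eq_empty (h i)) k

/-! ### Matrices that are collapsed in both directions -/

theorem ht_le_of_row_eq_zero {L n : ℕ} {X : Matrix (Fin L) (Fin n) Bool} {i x : ℕ}
    (h : ∀ c, x ≤ c → val X i c = 0) {y : ℕ} (hy : x ≤ y) : ht X i x ≤ ht X i y := by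
  obtain ⟨d, rfl⟩ := Nat.exists_eq_add_of_le hy
  induction d with
  | zero => rfl
  | succ d ih =>
    have := ih (by omega)
    have := val_bounds X (i + 1) (x + d)
    rw [← add_assoc, ht_succ, h (x + d) (by omega)]
    omega

theorem colHt_eq_of_rows_eq {L n : ℕ} {X : Matrix (Fin L) (Fin n) Bool} {j r : ℕ}
    (h : ∀ r' < r, val X r' (j + 1) = val X r' j) : colHt X j 0 = colHt X j r := by
  induction r with
  | zero => rfl
  | succ r ih =>
    rw [ih fun r' hr' => h r' (by omega), colHt_eq, h r (by omega)]
    omega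

/-- Without balls unmatched above in any row or column, the balls form the staircase shape of a
partition in the bottom left corner. -/
theorem staircase_of_unmatched_eq_empty {L n : ℕ} {X : Matrix (Fin L) (Fin n) Bool}
    (h : ∀ i, unmatched X i = ∅) (h' : ∀ j, unmatched (rot X) j = ∅) {r c r' c' : ℕ}
    (hX : val X r c = 1) (hr : r' ≤ r) (hc : c' ≤ c) : val X r' c' = 1 := by
  have hrow : ∀ i x, ht X i n ≤ ht X i x := fun i => unmatched_eq_empty_iff.1 (h i)
  have hcol : ∀ j r, colHt X j 0 ≤ colHt X j r := fun j r =>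
    unmatched_eq_empty_iff.1 (h' j) (L - r)
  have key : ∀ r, (∀ c c', c' ≤ c → val X r c = 1 → val X r c' = 1) ∧
      ∀ r' ≤ r, ∀ c, val X r c = 1 → val X r' c = 1 := by
    intro r
    induction r using Nat.strong_induction_on with
    | _ r ih =>
      have hdown : ∀ r' ≤ r, ∀ c, val X r c = 1 → val X r' c = 1 := by
        intro r' hr' c hc
        rcases hr'.lt_or_eq with hlt | rfl
        · obtain ⟨s, rfl⟩ : ∃ s, r = s + 1 := ⟨r - 1, by omega⟩
          obtain ⟨i1, i2⟩ := ih s (by omega)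
          refine i2 r' (by omega) c ?_
          by_contra hs
          -- Row `s` is an initial segment, so a vacancy at `c` leaves it without balls weakly right
          -- of `c`. The ball above the vacancy then could not be matched.
          have hz : ∀ c', c ≤ c' → val X s c' = 0 := by
            intro c' hc'
            rcases val_eq_zero_or_one X s c' with h0 | h1
            · exact h0
            · exact absurd (i1 c' c hc' h1) hs
          have hcn : c < n := by
            by_contra hh
            rw [val_col_of_le _ _ (by omega)] at hc
            omega
          have e1 := ht_le_of_row_eq_zero (x := c + 1) (fun c' hc' => hz c' (by omega)) hcn
          have e2 := ht_succ X s c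
          have e3 := hrow s c
          rw [hz c le_rfl] at e2
          omega
        · exact hc
      refine ⟨?_, hdown⟩
      have hone : ∀ c, val X r (c + 1) = 1 → val X r c = 1 := by
        intro c hc
        by_contra hcon
        have hc0 : val X r c = 0 := (val_eq_zero_or_one X r c).resolve_right hcon
        -- Below row `r` the columns `c` and `c + 1` agree, so nothing there could match a ball at
        -- `c + 1` with a vacancy at `c`.
        have e1 := colHt_eq_of_rows_eq (X := X) (j := c) (r := r) fun r' hr' => by
          have := hdown r' hr'.le _ hc
          rw [this, (ih r' hr').1 (c + 1) c (by omega) this]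
        have e2 := colHt_eq X c r
        have e3 := hcol c (r + 1)
        omega
      intro c c' hcc
      induction hcc with
      | refl => exact id
      | step _ ih' => exact fun hh => ih' (hone _ hh)
  exact (key r').1 c c' hc ((key r).2 r' hr c hX)

theorem eq_one_iff_lt_sum {v : ℕ → ℤ} (h01 : ∀ c, v c = 0 ∨ v c = 1)
    (hv : ∀ c c', v c = 1 → c' ≤ c → v c' = 1) (n : ℕ) (hn : ∀ c, n ≤ c → v c = 0) (c : ℕ) :
    v c = 1 ↔ (c : ℤ) < ∑ k ∈ Finset.range n, v k := by
  induction n with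
  | zero => simp [hn c]
  | succ n ih =>
    rcases h01 n with h | h
    · rw [Finset.sum_range_succ, h, add_zero]
      refine ih fun c hc => ?_
      rcases hc.lt_or_eq with h1 | rfl
      · exact hn c h1
      · exact h
    · have : ∑ k ∈ Finset.range (n + 1), v k = ((n + 1 : ℕ) : ℤ) := by
        rw [Finset.sum_congr rfl fun k hk => hv n k h (by simp at hk; omega)]
        simp
      rw [this]
      constructor
      · intro h1
        by_contra h2
        have := hn c (by omega)
        omega
      · intro h1
        exact hv n c h (by omega)

/-- The number of balls in row `r`. -/
def rowSum {L n : ℕ} (X : Matrix (Fin L) (Fin n) Bool) (r : ℕ) : ℤ :=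
  ∑ c ∈ Finset.range n, val X r c

/-- The number of balls in column `c`. -/
def colSum {L n : ℕ} (X : Matrix (Fin L) (Fin n) Bool) (c : ℕ) : ℤ :=
  ∑ r ∈ Finset.range L, val X r c

theorem card_rowSet {L n : ℕ} (X : Matrix (Fin L) (Fin n) Bool) (r : ℕ) :
    ((rowSet X r).card : ℤ) = rowSum X r := by
  rw [rowSum, Finset.sum_range]
  simp [val_eq_ite]

theorem rowSum_rot {L n : ℕ} (X : Matrix (Fin L) (Fin n) Bool) (c : ℕ) :
    rowSum (rot X) c = colSum X c := by
  rw [rowSum, colSum, ← Finset.sum_range_reflect]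
  refine Finset.sum_congr rfl fun k hk => ?_
  rw [Finset.mem_range] at hk
  rw [val_rot, if_pos (by omega), show L - 1 - (L - 1 - k) = k by omega]

theorem colSum_rot {L n : ℕ} (X : Matrix (Fin L) (Fin n) Bool) {r : ℕ} (hr : r < L) :
    colSum (rot X) (L - 1 - r) = rowSum X r := by
  refine Finset.sum_congr rfl fun k _ => ?_
  rw [val_rot, if_pos (by omega), show L - 1 - (L - 1 - r) = r by omega]

theorem colSum_dropStar {L n : ℕ} (B : Matrix (Fin L) (Fin n) Bool) (i c : ℕ) :
    colSum (dropStar i B) c = colSum B c := by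
  unfold colSum
  by_cases hc : c < n
  · have e := fun r => val_dropStar B i r ⟨c, hc⟩
    simp only at e
    rw [Finset.sum_congr rfl fun r _ => e r, Finset.sum_add_distrib]
    by_cases hU : (⟨c, hc⟩ : Fin n) ∈ unmatched B i
    · have := lt_of_mem_unmatched hU
      simp only [hU, if_true, Finset.sum_sub_distrib, Finset.sum_ite_eq', Finset.mem_range]
      rw [if_pos (by omega), if_pos (by omega)]
      ring
    · simp [hU]
  · refine Finset.sum_congr rfl fun r _ => ?_
    rw [val_col_of_le _ _ (by omega), val_col_of_le _ _ (by omega)]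

theorem colSum_rhoDown {L n : ℕ} (B : Matrix (Fin L) (Fin n) Bool) (c : ℕ) :
    colSum (rhoDown B) c = colSum B c :=
  collapseRows_induction (P := fun f => ∀ B, colSum (f B) c = colSum B c) (fun _ => rfl)
    (fun hf hg B => (hf _).trans (hg B)) (fun i B => colSum_dropStar B i c) (L - 1) B

theorem rot_rhoLeft {L n : ℕ} (B : Matrix (Fin L) (Fin n) Bool) :
    rot (rhoLeft B) = rhoDown (rot B) := by
  rw [rhoLeft, rot_rotInv]

theorem rowSum_rhoLeft {L n : ℕ} (B : Matrix (Fin L) (Fin n) Bool) (r : ℕ) :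
    rowSum (rhoLeft B) r = rowSum B r := by
  by_cases hr : r < L
  · rw [← colSum_rot _ hr, rot_rhoLeft, colSum_rhoDown, colSum_rot _ hr]
  · unfold rowSum
    refine Finset.sum_congr rfl fun c _ => ?_
    rw [val_row_of_le _ _ (by omega), val_row_of_le _ _ (by omega)]

theorem val_eq_one_iff_lt_rowSum {L n : ℕ} {X : Matrix (Fin L) (Fin n) Bool}
    (h : ∀ i, unmatched X i = ∅) (h' : ∀ j, unmatched (rot X) j = ∅) (r c : ℕ) :
    val X r c = 1 ↔ (c : ℤ) < rowSum X r :=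
  eq_one_iff_lt_sum (val_eq_zero_or_one X r)
    (fun _ _ hX hc => staircase_of_unmatched_eq_empty h h' hX le_rfl hc) n
    (fun _ hc => val_col_of_le X r hc) c

theorem val_eq_one_iff_lt_colSum {L n : ℕ} {X : Matrix (Fin L) (Fin n) Bool}
    (h : ∀ i, unmatched X i = ∅) (h' : ∀ j, unmatched (rot X) j = ∅) (r c : ℕ) :
    val X r c = 1 ↔ (r : ℤ) < colSum X c :=
  eq_one_iff_lt_sum (fun r => val_eq_zero_or_one X r c)
    (fun _ _ hX hr => staircase_of_unmatched_eq_empty h h' hX hr le_rfl) L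
    (fun _ hr => val_row_of_le X c hr) r

theorem exists_youngDiagram {L n : ℕ} {X : Matrix (Fin L) (Fin n) Bool}
    (h : ∀ i, unmatched X i = ∅) (h' : ∀ j, unmatched (rot X) j = ∅) :
    ∃ lam : YoungDiagram, lam.colLen 0 ≤ n ∧ lam.rowLen 0 ≤ L ∧
      (∀ r, rowSum X r = lam.colLen r) ∧ ∀ c, colSum X c = lam.rowLen c := by
  have hmem : ∀ r c, val X r c = 1 → r < L ∧ c < n := by
    intro r c hX
    constructor
    · by_contra hh
      rw [val_row_of_le _ _ (by omega)] at hX; omega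
    · by_contra hh
      rw [val_col_of_le _ _ (by omega)] at hX; omega
  -- The first coordinate of a cell is the column of the ball: the parts of `lam` are the column
  -- sums, and those of its conjugate are the row sums.
  let lam : YoungDiagram :=
    { cells := (Finset.range n ×ˢ Finset.range L).filter fun x => val X x.2 x.1 = 1
      isLowerSet := by
        rintro ⟨c, r⟩ ⟨c', r'⟩ hle hm
        obtain ⟨hc, hr⟩ := Prod.mk_le_mk.1 hle
        simp only [Finset.coe_filter, Set.mem_ofPred_eq, Finset.mem_product,
          Finset.mem_range] at hm ⊢
        have := staircase_of_unmatched_eq_empty h h' hm.2 hr hc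
        exact ⟨(hmem _ _ this).symm, this⟩ }
  have hlam : ∀ r c, (c, r) ∈ lam ↔ val X r c = 1 := by
    intro r c
    rw [← YoungDiagram.mem_cells]
    simp only [lam, Finset.mem_filter, Finset.mem_product, Finset.mem_range]
    exact ⟨fun hx => hx.2, fun hx => ⟨(hmem _ _ hx).symm, hx⟩⟩
  have hc : ∀ r c, c < lam.colLen r ↔ (c : ℤ) < rowSum X r := fun r c => by
    rw [← YoungDiagram.mem_iff_lt_colLen, hlam, val_eq_one_iff_lt_rowSum h h']
  have hr : ∀ r c, r < lam.rowLen c ↔ (r : ℤ) < colSum X c := fun r c => by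
    rw [← YoungDiagram.mem_iff_lt_rowLen, hlam, val_eq_one_iff_lt_colSum h h']
  refine ⟨lam, ?_, ?_, fun r => ?_, fun c => ?_⟩
  · by_contra hcon
    have h1 : (n, 0) ∈ lam := YoungDiagram.mem_iff_lt_colLen.2 (by omega)
    have := hmem _ _ ((hlam _ _).1 h1)
    omega
  · by_contra hcon
    have h1 : (0, L) ∈ lam := YoungDiagram.mem_iff_lt_rowLen.2 (by omega)
    have := hmem _ _ ((hlam _ _).1 h1)
    omega
  · have h1 := hc r (lam.colLen r)
    have h2 := hc r (rowSum X r).toNat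
    have h3 := card_rowSet X r
    omega
  · have h1 := hr (lam.rowLen c) c
    have h2 := hr (colSum X c).toNat c
    have h3 := card_rowSet (rot X) c
    rw [rowSum_rot] at h3
    omega

/-- A staircase is determined by its row sums and also by its column sums. The mixed form fits
leftward collapsing, which preserves row sums, and downward collapsing, which preserves column sums.
-/
theorem eq_of_rowSum_of_colSum {L n : ℕ} {X Y : Matrix (Fin L) (Fin n) Bool} {lam : YoungDiagram}
    (hX : ∀ i, unmatched X i = ∅) (hX' : ∀ j, unmatched (rot X) j = ∅)
    (hY : ∀ i, unmatched Y i = ∅) (hY' : ∀ j, unmatched (rot Y) j = ∅)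
    (hr : ∀ r, rowSum X r = lam.colLen r) (hc : ∀ c, colSum Y c = lam.rowLen c) : X = Y := by
  refine ext_val fun r c => ?_
  have h1 := val_eq_one_iff_lt_rowSum hX hX' r c
  have h2 := val_eq_one_iff_lt_colSum hY hY' r c
  rw [hr, Nat.cast_lt, ← YoungDiagram.mem_iff_lt_colLen] at h1
  rw [hc, Nat.cast_lt, ← YoungDiagram.mem_iff_lt_rowLen] at h2
  have h3 := h1.trans h2.symm
  have := val_eq_zero_or_one X r c
  have := val_eq_zero_or_one Y r c
  omega

/-! ### Nonwrapping multiline queues -/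

theorem le_of_find?_eq_some {n : ℕ} {l : List (Fin n)} (hl : l.Pairwise (· < ·))
    {p : Fin n → Bool} {d : Fin n} (h : l.find? p = some d) {e : Fin n} (he : e ∈ l)
    (hp : p e = true) : d ≤ e := by
  induction l with
  | nil => simp at he
  | cons a l ih =>
    rw [List.pairwise_cons] at hl
    rw [List.find?_cons] at h
    cases ha : p a with
    | true =>
      rw [ha] at h
      obtain rfl : a = d := by simpa using h
      rcases List.mem_cons.1 he with rfl | he
      · exact le_rfl
      · exact (hl.1 e he).le
    | false =>
      rw [ha] at h
      rcases List.mem_cons.1 he with rfl | he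
      · simp [ha] at hp
      · exact ih hl.2 h he

theorem firstFree_eq_none {n : ℕ} {U : Finset (Fin n)} {a : Fin n} (h : firstFree U a = none) :
    U = ∅ := by
  unfold firstFree at h
  rw [List.find?_eq_none] at h
  refine Finset.eq_empty_of_forall_notMem fun c hc => ?_
  exact h c (by rcases le_or_gt a c with h | h <;> simp [h]) (by simpa using hc)

theorem firstFree_eq_some {n : ℕ} {U : Finset (Fin n)} {a d : Fin n}
    (h : firstFree U a = some d) : d ∈ U ∧ ∀ e ∈ U, a ≤ e → a ≤ d ∧ d ≤ e := by
  unfold firstFree at h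
  refine ⟨by simpa using List.find?_some h, fun e he hae => ?_⟩
  rw [List.find?_append] at h
  cases h1 : ((List.finRange n).filter (fun d => a ≤ d)).find? (fun d => d ∈ U) with
  | none =>
    rw [List.find?_eq_none] at h1
    exact absurd (by simpa using he) (h1 e (by simpa using hae))
  | some d' =>
    rw [h1] at h
    obtain rfl : d' = d := by simpa using h
    have hd := List.mem_of_find?_eq_some h1
    exact ⟨by simpa using hd, le_of_find?_eq_some
      ((List.pairwise_lt_finRange n).filter _) h1 (by simpa using hae) (by simpa using he)⟩

theorem mem_of_mem_pairUp {n : ℕ} {l : List (Fin n)} {U : Finset (Fin n)} {p : Fin n × Fin n}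
    (h : p ∈ pairUp l U) : p.1 ∈ l ∧ p.2 ∈ U := by
  induction l generalizing U with
  | nil => simp [pairUp] at h
  | cons a l ih =>
    rw [pairUp] at h
    cases hd : firstFree U a with
    | none =>
      rw [hd] at h
      exact ⟨List.mem_cons_of_mem _ (ih h).1, (ih h).2⟩
    | some d =>
      rw [hd] at h
      rcases List.mem_cons.1 h with rfl | h
      · exact ⟨List.mem_cons_self, (firstFree_eq_some hd).1⟩
      · exact ⟨List.mem_cons_of_mem _ (ih h).1, Finset.mem_of_mem_erase (ih h).2⟩

theorem cardGe_erase {n : ℕ} {U : Finset (Fin n)} {d : Fin n} (hd : d ∈ U) (x : ℕ) :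
    cardGe U x = cardGe (U.erase d) x + if x ≤ (d : ℕ) then 1 else 0 := by
  conv_lhs => rw [← Finset.insert_erase hd]
  unfold cardGe
  rw [Finset.filter_insert]
  split_ifs
  · rw [Finset.card_insert_of_notMem (by simp)]
  · rfl

/-- A criterion of Hall type for the greedy pairing. It does not see the order of `l`, which is why
the labels play no role in deciding whether the major index vanishes. The length hypothesis ensures
that every ball finds a partner. -/
theorem pairUp_nonwrapping_iff {n : ℕ} (l : List (Fin n)) (U : Finset (Fin n))
    (hl : l.length ≤ U.card) :
    (∀ p ∈ pairUp l U, p.1 ≤ p.2) ↔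
      ∀ x : ℕ, l.countP (fun a : Fin n => x ≤ (a : ℕ)) ≤ cardGe U x := by
  induction l generalizing U with
  | nil => simp [pairUp]
  | cons a l ih =>
    rw [List.length_cons] at hl
    rw [pairUp]
    cases hd : firstFree U a with
    | none =>
      rw [firstFree_eq_none hd] at hl
      simp at hl
    | some d =>
      obtain ⟨hdU, hmin⟩ := firstFree_eq_some hd
      have hcard := Finset.card_erase_of_mem hdU
      have ih := ih (U.erase d) (by omega)
      simp only [List.forall_mem_cons, ih, List.countP_cons, decide_eq_true_eq, cardGe_erase hdU]
      constructor
      · rintro ⟨h1, h2⟩ x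
        have := h2 x
        rw [Fin.le_def] at h1
        split_ifs <;> omega
      · intro h
        have had : a ≤ d := by
          by_contra hcon
          have h1 := h a
          rw [← cardGe_erase hdU, if_pos le_rfl] at h1
          have h2 : 0 < cardGe U a := by omega
          obtain ⟨e, he⟩ := Finset.card_pos.1 h2
          rw [Finset.mem_filter] at he
          exact hcon (hmin e he.1 he.2).1
        refine ⟨had, fun x => ?_⟩
        rw [Fin.le_def] at had
        have h1 := h x
        -- In the critical range `a < x ≤ d` there is no free ball from `a` up to just before `d`,
        -- so the bound at `x` follows from the one at `a`.
        by_cases hx : (a : ℕ) < x ∧ x ≤ (d : ℕ)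
        · have h2 := h a
          rw [if_pos le_rfl, if_pos had] at h2
          have h3 : cardGe (U.erase d) a ≤ cardGe (U.erase d) x := by
            refine Finset.card_le_card fun e he => ?_
            rw [Finset.mem_filter] at he ⊢
            have := (hmin e (Finset.mem_of_mem_erase he.1) he.2).2
            rw [Fin.le_def] at this
            exact ⟨he.1, by omega⟩
          have h4 : l.countP (fun a : Fin n => x ≤ (a : ℕ)) ≤ l.countP (fun b : Fin n => (a : ℕ) ≤ (b : ℕ)) :=
            List.countP_mono_left fun b _ hb => by
              simp only [decide_eq_true_eq] at hb ⊢
              omega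
          omega
        · split_ifs at h1 <;> omega

theorem countP_pairingOrder {n : ℕ} {lab : Fin n → ℕ} {A : Finset (Fin n)}
    (h : ∀ c, 0 < lab c ↔ c ∈ A) (x : ℕ) :
    (pairingOrder lab).countP (fun a : Fin n => x ≤ (a : ℕ)) = cardGe A x := by
  unfold pairingOrder
  rw [(List.mergeSort_perm _ _).countP_eq, List.countP_eq_length_filter, List.filter_filter,
    ← List.toFinset_card_of_nodup ((List.nodup_finRange n).filter _), cardGe]
  congr 1
  ext c
  simp [h, and_comm]

theorem length_pairingOrder {n : ℕ} {lab : Fin n → ℕ} {A : Finset (Fin n)}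
    (h : ∀ c, 0 < lab c ↔ c ∈ A) : (pairingOrder lab).length = A.card := by
  have := countP_pairingOrder h 0
  rw [List.countP_eq_length.2 (by simp), cardGe, Finset.filter_true_of_mem (by simp)] at this
  exact this

theorem pos_of_mem_pairingOrder {n : ℕ} {lab : Fin n → ℕ} {a : Fin n} (h : a ∈ pairingOrder lab) :
    0 < lab a := by
  unfold pairingOrder at h
  rw [List.mem_mergeSort] at h
  simpa using h

/-- This makes the truncated subtraction in `maj` positive for every wrapping pairing, so no
wrapping goes unnoticed. -/
theorem lt_fmLabels {n : ℕ} (M : ℕ → Finset (Fin n)) (m r : ℕ) (c : Fin n)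
    (h : 0 < fmLabels M m r c) : r < fmLabels M m r c := by
  induction m generalizing r c with
  | zero => simp [fmLabels] at h
  | succ m ih =>
    rw [fmLabels, nextLabels] at h ⊢
    split at h
    · rename_i p hp
      have := ih (r + 1) p.1 h
      omega
    · split_ifs at h ⊢
      · simp
      · simp at h

theorem fmLabels_pos_iff {n : ℕ} (M : ℕ → Finset (Fin n)) (m r : ℕ) (c : Fin n) :
    0 < fmLabels M (m + 1) r c ↔ c ∈ M r := by
  rw [fmLabels, nextLabels]
  split
  · rename_i p hp
    have h1 := List.mem_of_find?_eq_some hp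
    have h2 := List.find?_some hp
    obtain ⟨h3, h4⟩ := mem_of_mem_pairUp h1
    simp only [decide_eq_true_eq] at h2
    rw [← h2]
    exact ⟨fun _ => h4, fun _ => pos_of_mem_pairingOrder h3⟩
  · split_ifs with h <;> simp [h]

theorem maj_eq_zero_iff_le {n : ℕ} (k : ℕ) (M : ℕ → Finset (Fin n)) :
    maj k M = 0 ↔ ∀ r < k - 1, ∀ p ∈ rowPairings (fmLabels M (k - 1 - r) (r + 1)) (M r),
      p.1 ≤ p.2 := by
  unfold maj
  rw [Finset.sum_eq_zero_iff]
  simp only [Finset.mem_range]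
  refine forall_congr' fun r => imp_congr_right fun hr => ?_
  rw [List.sum_eq_zero_iff]
  simp only [List.mem_map, forall_exists_index, and_imp, forall_apply_eq_imp_iff₂]
  refine forall_congr' fun p => imp_congr_right fun hp => ?_
  have h1 := lt_fmLabels M _ _ _ (pos_of_mem_pairingOrder (mem_of_mem_pairUp hp).1)
  split_ifs with h
  · refine ⟨fun h2 => by omega, fun h2 => absurd h (not_lt.2 h2)⟩
  · exact ⟨fun _ => not_lt.1 h, fun _ => rfl⟩

theorem maj_eq_zero_iff {n : ℕ} {lam : YoungDiagram} {M : ℕ → Finset (Fin n)}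
    (hM : M ∈ MLQ lam n) :
    maj (lam.rowLen 0) M = 0 ↔ ∀ r x, cardGe (M (r + 1)) x ≤ cardGe (M r) x := by
  have hM' : ∀ j, (M j).card = lam.colLen j := hM
  have key : ∀ r < lam.rowLen 0 - 1,
      ((∀ p ∈ rowPairings (fmLabels M (lam.rowLen 0 - 1 - r) (r + 1)) (M r), p.1 ≤ p.2) ↔
        ∀ x, cardGe (M (r + 1)) x ≤ cardGe (M r) x) := by
    intro r hr
    obtain ⟨m, hm⟩ : ∃ m, lam.rowLen 0 - 1 - r = m + 1 := ⟨lam.rowLen 0 - 1 - r - 1, by omega⟩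
    rw [hm]
    have hpos := fmLabels_pos_iff M m (r + 1)
    rw [rowPairings, pairUp_nonwrapping_iff]
    · simp only [countP_pairingOrder hpos]
    · rw [length_pairingOrder hpos, hM', hM']
      exact lam.colLen_anti _ _ (by omega)
  rw [maj_eq_zero_iff_le]
  constructor
  · intro h r
    by_cases hr : r < lam.rowLen 0 - 1
    · exact (key r hr).1 (h r hr)
    · intro x
      -- From the top row of the shape on, the next row is empty.
      have h1 : (0, r + 1) ∉ lam := by
        rw [YoungDiagram.mem_iff_lt_rowLen]; omega
      rw [YoungDiagram.mem_iff_lt_colLen, ← hM'] at h1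
      have : cardGe (M (r + 1)) x ≤ (M (r + 1)).card := Finset.card_filter_le _ _
      omega
  · exact fun h r hr => (key r hr).2 (h r)

theorem rowSet_mem_MLQ0_iff {L n : ℕ} {B : Matrix (Fin L) (Fin n) Bool} {lam : YoungDiagram} :
    rowSet B ∈ MLQ0 lam n ↔
      (∀ r, rowSum B r = lam.colLen r) ∧ ∀ i, unmatched B i = ∅ := by
  have h1 : rowSet B ∈ MLQ lam n ↔ ∀ r, rowSum B r = lam.colLen r :=
    forall_congr' fun r => by rw [← card_rowSet, Nat.cast_inj]
  unfold MLQ0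
  rw [Set.mem_ofPred_eq, ← h1]
  refine and_congr_right fun h => ?_
  rw [maj_eq_zero_iff h]
  exact forall_congr' fun i => unmatched_eq_empty_iff_cardGe.symm

theorem exists_rowSet_eq {L n : ℕ} {lam : YoungDiagram} {M : ℕ → Finset (Fin n)}
    (hM : M ∈ MLQ lam n) (hL : lam.rowLen 0 ≤ L) :
    ∃ B : Matrix (Fin L) (Fin n) Bool, rowSet B = M := by
  have hM' : ∀ j, (M j).card = lam.colLen j := hM
  refine ⟨fun r c => decide (c ∈ M r), funext fun r => ?_⟩
  ext c
  unfold rowSet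
  simp only [decide_eq_true_eq, Finset.mem_filter, Finset.mem_univ, true_and, exists_prop,
    and_iff_right_iff_imp]
  intro hc
  have h1 : 0 < lam.colLen r := by
    rw [← hM']
    exact Finset.card_pos.2 ⟨c, hc⟩
  rw [← YoungDiagram.mem_iff_lt_colLen, YoungDiagram.mem_iff_lt_rowLen] at h1
  omega

theorem rowSet_injective {L n : ℕ} : Function.Injective (rowSet (L := L) (n := n)) := by
  intro B B' h
  funext r c
  have h1 : c ∈ rowSet B r ↔ c ∈ rowSet B' r := by rw [h]
  rw [mem_rowSet, mem_rowSet, val_fin, val_fin] at h1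
  cases h2 : B r c <;> cases h3 : B' r c <;> simp_all

/-! ### The bijection -/

theorem unmatched_rot_rhoLeft {L n : ℕ} (B : Matrix (Fin L) (Fin n) Bool) (j : ℕ) :
    unmatched (rot (rhoLeft B)) j = ∅ := by
  rw [rot_rhoLeft]
  exact unmatched_rhoDown _ j

/-- The hypothesis makes `B` a fixed point of `rhoLeft`; since the collapsings commute, `rhoDown B`
is one too, and lies in the image of `rhoLeft`. -/
theorem unmatched_rot_rhoDown {L n : ℕ} {B : Matrix (Fin L) (Fin n) Bool}
    (h : ∀ j, unmatched (rot B) j = ∅) (j : ℕ) : unmatched (rot (rhoDown B)) j = ∅ := by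
  have h1 := cartesian_rhoLeft_rhoDown.comm B
  have h2 : rhoLeft B = B := by
    rw [rhoLeft, rhoDown, collapseRows_of_unmatched h, rotInv_rot]
  rw [h2] at h1
  rw [← h1]
  exact unmatched_rot_rhoLeft _ j

end MLQueue

theorem mainTheorem6 (L n : ℕ) (hL : 0 < L) (hn : 0 < n) :
    Set.BijOn (MLQueue.mRSK (L := L) (n := n)) Set.univ
      (⋃ lam ∈ {lam : YoungDiagram | lam.colLen 0 ≤ n ∧ lam.transpose.colLen 0 ≤ L},
        MLQueue.MLQ0 lam.transpose L ×ˢ MLQueue.MLQ0 lam n) := by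
  open MLQueue in
  refine ⟨?_, ?_, ?_⟩
  · intro B _
    -- The shape is read off the doubly collapsed matrix, which has the row sums of `rhoDown B` and
    -- the column sums of `rhoLeft B`.
    obtain ⟨lam, h1, h2, h3, h4⟩ := exists_youngDiagram (X := rhoDown (rhoLeft B))
      (unmatched_rhoDown _) (unmatched_rot_rhoDown (unmatched_rot_rhoLeft B))
    rw [Set.mem_iUnion₂]
    refine ⟨lam, ⟨h1, by rwa [YoungDiagram.colLen_transpose]⟩, ?_, ?_⟩
    · refine rowSet_mem_MLQ0_iff.2 ⟨fun c => ?_, unmatched_rot_rhoLeft B⟩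
      rw [rowSum_rot, YoungDiagram.colLen_transpose, ← h4, colSum_rhoDown]
    · refine rowSet_mem_MLQ0_iff.2 ⟨fun r => ?_, unmatched_rhoDown B⟩
      rw [← h3, ← cartesian_rhoLeft_rhoDown.comm, rowSum_rhoLeft]
  · intro B _ B' _ h
    obtain ⟨h1, h2⟩ := Prod.mk.inj h
    exact cartesian_rhoLeft_rhoDown.inj (rot_injective (rowSet_injective h1))
      (rowSet_injective h2)
  · rintro ⟨P, Q⟩ h
    obtain ⟨lam, ⟨h1, h2⟩, hP, hQ⟩ := Set.mem_iUnion₂.1 h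
    simp only at hP hQ
    rw [YoungDiagram.colLen_transpose] at h2
    obtain ⟨q, rfl⟩ := exists_rowSet_eq hQ.1 h2
    obtain ⟨p', rfl⟩ := exists_rowSet_eq (L := n) hP.1 (by rwa [YoungDiagram.rowLen_transpose])
    obtain ⟨p, rfl⟩ : ∃ p, rot p = p' := ⟨rotInv p', rot_rotInv p'⟩
    obtain ⟨p1, p2⟩ := rowSet_mem_MLQ0_iff.1 hP
    obtain ⟨q1, q2⟩ := rowSet_mem_MLQ0_iff.1 hQ
    have hq : ∀ i, unmatched (rhoLeft q) i = ∅ := by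
      intro i
      have e := cartesian_rhoLeft_rhoDown.comm q
      rw [rhoDown, collapseRows_of_unmatched q2] at e
      rw [e]
      exact unmatched_rhoDown _ i
    -- Both sides are the staircase of `lam`, so the pullback property applies to the pair.
    have key : rhoLeft q = rhoDown p :=
      eq_of_rowSum_of_colSum (lam := lam) hq (unmatched_rot_rhoLeft q) (unmatched_rhoDown p)
        (unmatched_rot_rhoDown p2) (fun r => by rw [rowSum_rhoLeft, q1])
        (fun c => by
          rw [colSum_rhoDown, ← rowSum_rot, p1, YoungDiagram.colLen_transpose])
    obtain ⟨B, rfl, rfl⟩ := cartesian_rhoLeft_rhoDown.lift key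
    exact ⟨B, Set.mem_univ _, rfl⟩
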